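/- Let $K$ be an infinite field, $R=K[x,y,z]$, let $p_1,\dots,p_r$ ($r>1$) be distinct points of $\mathbb{P}^2(K)$ lying on an irreducible conic, and let $I\subseteq R$ be their homogeneous ideal. For $m\ge 0$ let $I^{(m)}=\bigcap_{\mathfrak p\in\operatorname{Ass}(R/I)}(I^mR_{\mathfrak p}\cap R)$ be the $m$-th symbolic power, and let $\operatorname{gin}(I^{(m)})$ be its generic initial ideal with respect to the (degree) reverse lexicographic order with $x>y>z$, that is, the common value of the initial ideals of $g\cdot I^{(m)}$ for all $g$ in some nonempty Zariski open subset of $GL_3(K)$. Then, for every $m$, $\operatorname{gin}(I^{(m)})$ exists and is generated by monomials in $x$ and $y$; let $P_m\subseteq\mathbb{R}^2$ be its Newton polytope, the convex hull of all $(i,j)$ with $x^iy^j\in\operatorname{gin}(I^{(m)})$. Moreover the limiting shape $P=\lim_{m\to\infty}\frac1m P_m$ (the closed set to which the sets $\frac1mP_m$ converge in the Hausdorff distance) exists, and: - if $r\ge 4$, then $P$ is the set of all points of $\mathbb{R}^2_{\ge 0}$ on or above the line through $(2,0)$ and $(0,\frac r2)$; - if $r=2$ or $r=3$, then $P$ is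 the set of all points of $\mathbb{R}^2_{\ge 0}$ on or above the line through $(\frac r2,0)$ and $(0,2)$. -/

import Mathlib

open scoped Pointwise LinearAlgebra.Projectivization

/-- The strict degree reverse lexicographic order on exponent vectors of monomials in
`x = X 0`, `y = X 1`, `z = X 2`, with `x > y > z`. -/
def RevLexLT (a b : Fin 3 →₀ ℕ) : Prop :=
  a.degree < b.degree ∨
    (a.degree = b.degree ∧ ∃ i : Fin 3, b i < a i ∧ ∀ j : Fin 3, i < j → a j = b j)

/-- `a` is the exponent of the initial (that is, largest) monomial occurring in `f`. -/
def IsInitialExponent {K : Type*} [Field K] (f : MvPolynomial (Fin 3) K) (a : Fin 3 →₀ ℕ) : Prop :=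
  a ∈ f.support ∧ ∀ b ∈ f.support, b ≠ a → RevLexLT b a

/-- The initial ideal of `I`, generated by the initial monomials of the elements of `I`. -/
noncomputable def initialIdeal {K : Type*} [Field K] (I : Ideal (MvPolynomial (Fin 3) K)) :
    Ideal (MvPolynomial (Fin 3) K) :=
  Ideal.span {t | ∃ f ∈ I, ∃ a, IsInitialExponent f a ∧ t = MvPolynomial.monomial a 1}

/-- The linear change of coordinates `X i ↦ ∑ j, g i j * X j`. -/
noncomputable def coordChange {K : Type*} [Field K] (g : GL (Fin 3) K) :
    MvPolynomial (Fin 3) K →ₐ[K] MvPolynomial (Fin 3) K :=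
  MvPolynomial.aeval fun i => ∑ j, MvPolynomial.C (g.1 i j) * MvPolynomial.X j

/-- `J` is the generic initial ideal of `I`: there is a nonempty Zariski open set of coordinate
changes `g` (given by the nonvanishing of a nonzero polynomial `F` in the matrix entries) such that
the initial ideal of `g • I` is `J` for all `g` in this set. -/
def IsGenericInitialIdeal {K : Type*} [Field K] (I J : Ideal (MvPolynomial (Fin 3) K)) : Prop :=
  ∃ F : MvPolynomial (Fin 3 × Fin 3) K, F ≠ 0 ∧
    ∀ g : GL (Fin 3) K, MvPolynomial.eval (fun ij => g.1 ij.1 ij.2) F ≠ 0 →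
      initialIdeal (I.map (coordChange g)) = J

open Classical in
/-- The generic initial ideal of `I` (with default value `⊥` in case there is none). -/
noncomputable def gin {K : Type*} [Field K] (I : Ideal (MvPolynomial (Fin 3) K)) :
    Ideal (MvPolynomial (Fin 3) K) :=
  if h : ∃ J, IsGenericInitialIdeal I J then h.choose else ⊥

/-- The `m`-th symbolic power of `I`: the intersection over the associated primes `P` of `R ⧸ I`
of the contractions to `R` of `I ^ m` extended to the localization `R_P`. -/
noncomputable def symbolicPower {R : Type*} [CommRing R] (I : Ideal R) (m : ℕ) : Ideal R :=
  ⨅ (P : PrimeSpectrum R) (_ : P.asIdeal ∈ associatedPrimes R (R ⧸ I)),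
    ((I ^ m).map (algebraMap R (Localization.AtPrime P.asIdeal))).comap
      (algebraMap R (Localization.AtPrime P.asIdeal))

/-- The ideal of a set `Z` of points of the projective plane: all polynomials that vanish at all
vectors of homogeneous coordinates of all points of `Z`. As `K` is infinite, this is the
homogeneous ideal generated by the forms that vanish on `Z`. -/
noncomputable def pointsIdeal {K : Type*} [Field K] [Infinite K] (Z : Set (ℙ K (Fin 3 → K))) :
    Ideal (MvPolynomial (Fin 3) K) :=
  MvPolynomial.vanishingIdeal K {v : Fin 3 → K | ∃ hv : v ≠ 0, Projectivization.mk K v hv ∈ Z}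

/-- The points of `Z` lie on an irreducible conic. -/
def LieOnIrreducibleConic {K : Type*} [Field K] (Z : Set (ℙ K (Fin 3 → K))) : Prop :=
  ∃ C : MvPolynomial (Fin 3) K, C.IsHomogeneous 2 ∧ Irreducible C ∧
    ∀ q ∈ Z, MvPolynomial.eval q.rep C = 0

/-- `J` is generated by monomials in the variables `x` and `y`. -/
def IsGeneratedInXY {K : Type*} [Field K] (J : Ideal (MvPolynomial (Fin 3) K)) : Prop :=
  ∃ S : Set (ℕ × ℕ), J = Ideal.span
    ((fun e : ℕ × ℕ => (MvPolynomial.X 0 ^ e.1 * MvPolynomial.X 1 ^ e.2 :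
      MvPolynomial (Fin 3) K)) '' S)

/-- The Newton polytope, in the plane, of a monomial ideal `J` of `K[x, y, z]` that is generated by
monomials in `x` and `y`: the convex hull of all `(i, j)` with `x ^ i * y ^ j ∈ J`. -/
def newtonPolytope {K : Type*} [Field K] (J : Ideal (MvPolynomial (Fin 3) K)) : Set (ℝ × ℝ) :=
  convexHull ℝ {q | ∃ i j : ℕ,
    (MvPolynomial.X 0 ^ i * MvPolynomial.X 1 ^ j : MvPolynomial (Fin 3) K) ∈ J ∧
      q = ((i : ℝ), (j : ℝ))}

/-- The closed set `P` is the limiting shape of the system `a`: the limit, in the Hausdorff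
distance, of the sets `(1 / m) • newtonPolytope (a m)` as `m → ∞`. -/
def IsLimitingShape {K : Type*} [Field K] (a : ℕ → Ideal (MvPolynomial (Fin 3) K))
    (P : Set (ℝ × ℝ)) : Prop :=
  IsClosed P ∧ Filter.Tendsto
    (fun m : ℕ => Metric.hausdorffEDist ((1 / (m : ℝ)) • newtonPolytope (a m)) P)
    Filter.atTop (nhds 0)

/-- The points of the closed first quadrant on or above the line through `(s, 0)` and `(0, t)`,
for `s, t > 0`. -/
def regionAboveLine (s t : ℝ) : Set (ℝ × ℝ) :=
  {q | 0 ≤ q.1 ∧ 0 ≤ q.2 ∧ 1 ≤ q.1 / s + q.2 / t}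

/-! Let a form `f` of degree `N` in the symbolic power `I^(m)` be restricted to a line `t ↦ t • a +
b`. For the reverse lexicographic order the behaviour on `z = 0` decides everything: a general
linear form is a nonzerodivisor modulo `I^(m)`, so powers of `z` can be stripped off, and `gin` is
generated by the monomials `x ^ n * y ^ (N - n)` where `n` is the degree of a nonzero restriction of
a form of degree `N` to a general line (`initialIdeal_map_coordChange`). The theorem thus concerns
the sets of degrees `degSet`.

Lower bound (`le_natDegree_res`). If the degree of `f` is small against `m`, Bézout's theorem makes
`f` divisible by a fixed curve: the conic for `r ≥ 4`, the line through the points for `r = 2`, the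
triangle for `r = 3`. Dividing it out lowers the multiplicity by 1, 1 or 2. When no division is
possible any more, the degree itself gives the bound. By induction on `m` all generators lie on or
above the line with intercepts `min r 4 / 2` and `max r 4 / 2`, scaled by `m`. Bézout is obtained by
hand, by counting zeros along parametrized lines and conics (`aeval_path_eq_zero`).

Upper bound. The squared conic, of degree 4, and a closed polygon through the points, of degree `r`,
both lie in `I^(2)` and have no common zero on a general line. Powers of the one of smaller degree
give pure powers of `x` near the first intercept. Iterating the Bézout identity for the two
restrictions gives forms in `I^(2k)` with any prescribed restriction from degree `max r 4 * k + min
r 4` on (`exists_mem_symbolicPower_res_eq`), hence pure powers of `y` near the second intercept.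
Both errors are bounded, so they vanish after division by `m` (`isLimitingShape_of_bounds`).

The same surjectivity makes `degSet` independent of the general line in large degrees. The finitely
many remaining degrees are handled by semicontinuity of ranks (`exists_degSet_eq`), so `gin` exists.
-/

namespace FatPoints

open MvPolynomial

variable {K : Type*} [Field K]

/-! ### Linear forms and evaluation of forms -/

/-- The determinant of the matrix with columns `p`, `q`, `x`. -/
def det3 (p q x : Fin 3 → K) : K :=
  (p 1 * q 2 - p 2 * q 1) * x 0 + (p 2 * q 0 - p 0 * q 2) * x 1 + (p 0 * q 1 - p 1 * q 0) * x 2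

/-- The linear form `x ↦ det3 p q x`, which defines the line through `p` and `q`. -/
noncomputable def lineForm (p q : Fin 3 → K) : MvPolynomial (Fin 3) K :=
  C (p 1 * q 2 - p 2 * q 1) * X 0 + C (p 2 * q 0 - p 0 * q 2) * X 1 +
    C (p 0 * q 1 - p 1 * q 0) * X 2

@[simp]
theorem eval_lineForm (p q x : Fin 3 → K) : eval x (lineForm p q) = det3 p q x := by
  simp [lineForm, det3]

theorem isHomogeneous_lineForm (p q : Fin 3 → K) : (lineForm p q).IsHomogeneous 1 :=
  ((isHomogeneous_C_mul_X _ _).add (isHomogeneous_C_mul_X _ _)).add (isHomogeneous_C_mul_X _ _)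

theorem polynomial_eval_aeval {σ : Type*} (Γ : σ → Polynomial K) (f : MvPolynomial σ K) (t : K) :
    (aeval Γ f).eval t = eval (fun i => (Γ i).eval t) f := by
  induction f using MvPolynomial.induction_on with
  | C a => simp [Polynomial.algebraMap_eq]
  | add f g hf hg => simp [hf, hg]
  | mul_X f i hf => simp [hf]

theorem aeval_smul_of_isHomogeneous {σ A : Type*} [CommRing A] [Algebra K A]
    {f : MvPolynomial σ K} {d : ℕ} (hf : f.IsHomogeneous d) (c : A) (x : σ → A) :
    aeval (fun i => c * x i) f = c ^ d * aeval x f := by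
  rw [aeval_def, aeval_def, eval₂_eq, eval₂_eq, Finset.mul_sum]
  refine Finset.sum_congr rfl fun e he => ?_
  have hd : ∑ i ∈ e.support, e i = d := (hf.degree_eq_sum_deg_support he).symm
  simp only [mul_pow, Finset.prod_mul_distrib, Finset.prod_pow_eq_pow_sum, hd]
  ring

theorem eval_smul_of_isHomogeneous {σ : Type*} {f : MvPolynomial σ K} {d : ℕ}
    (hf : f.IsHomogeneous d) (c : K) (x : σ → K) : eval (c • x) f = c ^ d * eval x f := by
  have := aeval_smul_of_isHomogeneous hf c x
  rwa [aeval_eq_eval, aeval_eq_eval] at this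

/-! ### Ideals of points and their associated primes -/

/-- The ideal of polynomials vanishing on the line of `K ^ 3` spanned by `v`. -/
noncomputable def lineIdeal (v : Fin 3 → K) : Ideal (MvPolynomial (Fin 3) K) :=
  RingHom.ker (aeval (fun i => Polynomial.C (v i) * Polynomial.X) :
    MvPolynomial (Fin 3) K →ₐ[K] Polynomial K)

instance lineIdeal_isPrime (v : Fin 3 → K) : (lineIdeal v).IsPrime := RingHom.ker_isPrime _

theorem eval_aeval_ray (v : Fin 3 → K) (f : MvPolynomial (Fin 3) K) (c : K) :
    (aeval (fun i => Polynomial.C (v i) * Polynomial.X) f).eval c = eval (c • v) f := by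
  rw [polynomial_eval_aeval]
  have : (fun i => (Polynomial.C (v i) * Polynomial.X).eval c) = c • v := by
    funext i
    rw [Polynomial.eval_mul, Polynomial.eval_C, Polynomial.eval_X, mul_comm]
    rfl
  rw [this]

theorem eval_smul_eq_zero_of_mem_lineIdeal {v : Fin 3 → K} {f : MvPolynomial (Fin 3) K}
    (hf : f ∈ lineIdeal v) (c : K) : eval (c • v) f = 0 := by
  rw [← eval_aeval_ray, show aeval (fun i => Polynomial.C (v i) * Polynomial.X) f = 0 from hf,
    Polynomial.eval_zero]

theorem eval_eq_zero_of_mem_lineIdeal {v : Fin 3 → K} {f : MvPolynomial (Fin 3) K}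
    (hf : f ∈ lineIdeal v) : eval v f = 0 := by
  simpa using eval_smul_eq_zero_of_mem_lineIdeal hf 1

theorem mem_lineIdeal_of_forall [Infinite K] {v : Fin 3 → K} {f : MvPolynomial (Fin 3) K}
    (hf : ∀ c : K, c ≠ 0 → eval (c • v) f = 0) : f ∈ lineIdeal v := by
  refine Polynomial.eq_zero_of_infinite_isRoot _ ((Set.finite_singleton (0 : K)).infinite_compl.mono
    fun c hc => ?_)
  show Polynomial.eval c (aeval (fun i => Polynomial.C (v i) * Polynomial.X) f) = 0
  rw [eval_aeval_ray, hf c (by simpa using hc)]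

theorem mem_lineIdeal_of_isHomogeneous {v : Fin 3 → K} {f : MvPolynomial (Fin 3) K} {d : ℕ}
    (hf : f.IsHomogeneous d) (h0 : eval v f = 0) : f ∈ lineIdeal v := by
  show aeval (fun i => Polynomial.C (v i) * Polynomial.X) f = 0
  have := aeval_smul_of_isHomogeneous hf (Polynomial.X : Polynomial K)
    (fun i => Polynomial.C (v i))
  simp only [mul_comm Polynomial.X] at this
  rw [this]
  have h2 : aeval (fun i => Polynomial.C (v i)) f = Polynomial.C (eval v f) := by
    clear this h0 hf
    induction f using MvPolynomial.induction_on with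
    | C a => simp [Polynomial.algebraMap_eq]
    | add f g hf hg => simp [hf, hg]
    | mul_X f i hf => simp [hf]
  rw [h2, h0]; simp

/-- The ideal of the cone over a family of points of the projective plane. -/
noncomputable def coneIdeal {ι : Type*} (v : ι → Fin 3 → K) : Ideal (MvPolynomial (Fin 3) K) :=
  ⨅ i, lineIdeal (v i)

theorem mem_coneIdeal {ι : Type*} {v : ι → Fin 3 → K} {f : MvPolynomial (Fin 3) K} :
    f ∈ coneIdeal v ↔ ∀ i, f ∈ lineIdeal (v i) := by
  simp [coneIdeal]

theorem pointsIdeal_range_eq [Infinite K] {ι : Type*} (p : ι → ℙ K (Fin 3 → K)) :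
    pointsIdeal (Set.range p) = coneIdeal fun i => (p i).rep := by
  ext f
  rw [mem_coneIdeal, pointsIdeal, mem_vanishingIdeal_iff]
  constructor
  · intro h i
    refine mem_lineIdeal_of_forall fun c hc => ?_
    have hv : c • (p i).rep ≠ 0 := smul_ne_zero hc (p i).rep_nonzero
    simpa [aeval_eq_eval] using h (c • (p i).rep) ⟨hv, i, by
      conv_lhs => rw [← (p i).mk_rep]
      rw [Projectivization.mk_eq_mk_iff']
      exact ⟨c⁻¹, by rw [smul_smul, inv_mul_cancel₀ hc, one_smul]⟩⟩
  · rintro h x ⟨hx, i, hi⟩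
    rw [← (p i).mk_rep, eq_comm, Projectivization.mk_eq_mk_iff'] at hi
    obtain ⟨c, rfl⟩ := hi
    simpa [aeval_eq_eval] using eval_smul_eq_zero_of_mem_lineIdeal (h i) c

/-- The points of projective plane represented by `v` are pairwise distinct. -/
def PairwiseIndep {ι : Type*} (v : ι → Fin 3 → K) : Prop :=
  ∀ i j, i ≠ j → ∃ w, det3 (v i) (v j) w = 1

theorem exists_det3_eq_one {p q : Fin 3 → K} (hp : p ≠ 0) (h : ∀ c : K, q ≠ c • p) :
    ∃ w, det3 p q w = 1 := by
  have key : p 1 * q 2 - p 2 * q 1 ≠ 0 ∨ p 2 * q 0 - p 0 * q 2 ≠ 0 ∨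
      p 0 * q 1 - p 1 * q 0 ≠ 0 := by
    by_contra! hc
    obtain ⟨h0, h1, h2⟩ := hc
    obtain ⟨k, hk⟩ := Function.ne_iff.1 hp
    simp only [Pi.zero_apply] at hk
    refine h (q k / p k) (funext fun i => ?_)
    simp only [Pi.smul_apply, smul_eq_mul]
    rw [div_mul_eq_mul_div, eq_div_iff hk]
    fin_cases k <;> fin_cases i <;> simp only [Fin.zero_eta, Fin.mk_one, Fin.reduceFinMk] <;>
      first | ring1 | linear_combination h0 | linear_combination -h0 | linear_combination h1 |
        linear_combination -h1 | linear_combination h2 | linear_combination -h2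
  rcases key with h | h | h
  · exact ⟨![(p 1 * q 2 - p 2 * q 1)⁻¹, 0, 0], by simp [det3, h]⟩
  · exact ⟨![0, (p 2 * q 0 - p 0 * q 2)⁻¹, 0], by simp [det3, h]⟩
  · exact ⟨![0, 0, (p 0 * q 1 - p 1 * q 0)⁻¹], by simp [det3, h]⟩

theorem pairwiseIndep_rep {ι : Type*} {p : ι → ℙ K (Fin 3 → K)} (hp : Function.Injective p) :
    PairwiseIndep fun i => (p i).rep := by
  intro i j hij
  refine exists_det3_eq_one (p i).rep_nonzero fun c hc => hij (hp ?_)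
  rw [← (p i).mk_rep, ← (p j).mk_rep, eq_comm, Projectivization.mk_eq_mk_iff']
  exact ⟨c, hc.symm⟩

/-- A form vanishing at all the points but the one of index `i`. -/
theorem exists_separator {ι : Type*} [Finite ι] {v : ι → Fin 3 → K} (hv : PairwiseIndep v) (i : ι) :
    ∃ s, s ∉ lineIdeal (v i) ∧ ∀ j, j ≠ i → s ∈ lineIdeal (v j) := by
  classical
  have := Fintype.ofFinite ι
  have h : ∀ j, j ≠ i → ∃ l, l ∉ lineIdeal (v i) ∧ l ∈ lineIdeal (v j) := by
    intro j hj
    obtain ⟨w, hw⟩ := hv j i hj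
    refine ⟨lineForm (v j) w, fun hl => ?_, mem_lineIdeal_of_isHomogeneous
      (isHomogeneous_lineForm _ _) ?_⟩
    · have := eval_eq_zero_of_mem_lineIdeal hl
      rw [eval_lineForm] at this
      refine one_ne_zero (α := K) ?_
      rw [← hw, ← neg_eq_zero, ← this]
      simp only [det3]; ring
    · rw [eval_lineForm]; simp only [det3]; ring
  choose! l hl using h
  refine ⟨∏ j ∈ Finset.univ.erase i, l j, fun hs => ?_, fun j hj => ?_⟩
  · obtain ⟨j, hj, hj'⟩ := (Ideal.IsPrime.prod_mem_iff (s := Finset.univ.erase i)).1 hs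
    exact (hl j (Finset.ne_of_mem_erase hj)).1 hj'
  · exact Ideal.mem_of_dvd _ (Finset.dvd_prod_of_mem l (by simp [hj])) (hl j hj).2

theorem smul_mk_eq_zero_iff {R : Type*} [CommRing R] {I : Ideal R} (a x : R) :
    a • Ideal.Quotient.mk I x = 0 ↔ a * x ∈ I :=
  Ideal.Quotient.eq_zero_iff_mem (a := a * x)

/-- The prime is the annihilator of the class of a separator, a form vanishing at all the other
points but not at this one. -/
theorem lineIdeal_mem_associatedPrimes {ι : Type*} [Finite ι] {v : ι → Fin 3 → K}
    (hv : PairwiseIndep v) (i : ι) :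
    lineIdeal (v i) ∈ associatedPrimes (MvPolynomial (Fin 3) K)
      (MvPolynomial (Fin 3) K ⧸ coneIdeal v) := by
  obtain ⟨s, hs, hs'⟩ := exists_separator hv i
  refine Submodule.isAssociatedPrime_iff.2 ⟨inferInstance, Ideal.Quotient.mk _ s, ?_⟩
  ext a
  rw [Submodule.mem_colon_singleton, Submodule.mem_bot, smul_mk_eq_zero_iff, mem_coneIdeal]
  constructor
  · intro ha j
    by_cases hj : j = i
    · subst hj; exact Ideal.mul_mem_right _ _ ha
    · exact Ideal.mul_mem_left _ _ (hs' j hj)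
  · intro h
    exact ((Ideal.IsPrime.mem_or_mem inferInstance (h i)).resolve_right hs)

/-- An inclusion is enough for symbolic powers: a smaller prime has a larger complement, so its
contraction condition is weaker. -/
theorem exists_le_lineIdeal {ι : Type*} {v : ι → Fin 3 → K}
    {P : Ideal (MvPolynomial (Fin 3) K)}
    (hP : P ∈ associatedPrimes (MvPolynomial (Fin 3) K) (MvPolynomial (Fin 3) K ⧸ coneIdeal v)) :
    ∃ i, P ≤ lineIdeal (v i) := by
  obtain ⟨hprime, x, hx⟩ := Submodule.isAssociatedPrime_iff.1 hP
  obtain ⟨x, rfl⟩ := Ideal.Quotient.mk_surjective x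
  have key : ∀ a, a ∈ P ↔ a * x ∈ coneIdeal v := by
    intro a
    rw [hx, Submodule.mem_colon_singleton, Submodule.mem_bot, smul_mk_eq_zero_iff]
  have hxI : x ∉ coneIdeal v := fun h =>
    hprime.ne_top ((Ideal.eq_top_iff_one _).2 ((key 1).2 (by simpa using h)))
  rw [mem_coneIdeal] at hxI
  push Not at hxI
  obtain ⟨i, hi⟩ := hxI
  exact ⟨i, fun a ha => (Ideal.IsPrime.mem_or_mem inferInstance
    (mem_coneIdeal.1 ((key a).1 ha) i)).resolve_right hi⟩

theorem mem_symbolicPower_iff {ι : Type*} [Finite ι] {v : ι → Fin 3 → K} (hv : PairwiseIndep v)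
    {m : ℕ} {f : MvPolynomial (Fin 3) K} :
    f ∈ symbolicPower (coneIdeal v) m ↔
      ∀ i, ∃ s, s ∉ lineIdeal (v i) ∧ s * f ∈ coneIdeal v ^ m := by
  simp only [symbolicPower, Ideal.mem_iInf, Ideal.mem_comap]
  constructor
  · intro h i
    have := h ⟨lineIdeal (v i), inferInstance⟩ (lineIdeal_mem_associatedPrimes hv i)
    rwa [IsLocalization.algebraMap_mem_map_algebraMap_iff (lineIdeal (v i)).primeCompl] at this
  · intro h P hP
    rw [IsLocalization.algebraMap_mem_map_algebraMap_iff P.asIdeal.primeCompl]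
    obtain ⟨i, hi⟩ := exists_le_lineIdeal hP
    obtain ⟨s, hs, hsf⟩ := h i
    exact ⟨s, fun hsP => hs (hi hsP), hsf⟩

/-! ### Calculus of symbolic powers -/

section SymbolicPower

variable {ι : Type*} [Finite ι] {v : ι → Fin 3 → K}

theorem mem_symbolicPower_of_mem_pow (hv : PairwiseIndep v) {m : ℕ} {f : MvPolynomial (Fin 3) K}
    (hf : f ∈ coneIdeal v ^ m) : f ∈ symbolicPower (coneIdeal v) m :=
  (mem_symbolicPower_iff hv).2 fun i =>
    ⟨1, (Ideal.ne_top_iff_one _).1 (lineIdeal_isPrime (v i)).ne_top, by simpa using hf⟩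

theorem mul_mem_symbolicPower (hv : PairwiseIndep v) {m n : ℕ} {f g : MvPolynomial (Fin 3) K}
    (hf : f ∈ symbolicPower (coneIdeal v) m) (hg : g ∈ symbolicPower (coneIdeal v) n) :
    f * g ∈ symbolicPower (coneIdeal v) (m + n) := by
  rw [mem_symbolicPower_iff hv] at *
  intro i
  obtain ⟨s, hs, hsf⟩ := hf i
  obtain ⟨t, ht, htg⟩ := hg i
  refine ⟨s * t, fun h => ((lineIdeal_isPrime (v i)).mem_or_mem h).elim hs ht, ?_⟩
  rw [pow_add, mul_mul_mul_comm]
  exact Ideal.mul_mem_mul hsf htg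

theorem symbolicPower_antitone (hv : PairwiseIndep v) {m n : ℕ} (h : m ≤ n)
    {f : MvPolynomial (Fin 3) K} (hf : f ∈ symbolicPower (coneIdeal v) n) :
    f ∈ symbolicPower (coneIdeal v) m := by
  rw [mem_symbolicPower_iff hv] at *
  intro i
  obtain ⟨s, hs, hsf⟩ := hf i
  exact ⟨s, hs, Ideal.pow_le_pow_right h hsf⟩

theorem mem_symbolicPower_zero (hv : PairwiseIndep v) (f : MvPolynomial (Fin 3) K) :
    f ∈ symbolicPower (coneIdeal v) 0 :=
  mem_symbolicPower_of_mem_pow hv (by simp)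

theorem mem_symbolicPower_of_mul_mem (hv : PairwiseIndep v) {m : ℕ} {l f : MvPolynomial (Fin 3) K}
    (hl : ∀ i, l ∉ lineIdeal (v i)) (hf : l * f ∈ symbolicPower (coneIdeal v) m) :
    f ∈ symbolicPower (coneIdeal v) m := by
  rw [mem_symbolicPower_iff hv] at *
  intro i
  obtain ⟨s, hs, hsf⟩ := hf i
  exact ⟨s * l, fun h => ((lineIdeal_isPrime (v i)).mem_or_mem h).elim hs (hl i),
    by rwa [mul_assoc]⟩

/-- With a separator `s` of the point, `s * l` and `s * l'` vanish at all points, so `s ^ 2 * f`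
lies in the square of the ideal. -/
theorem mem_symbolicPower_two (hv : PairwiseIndep v) {f : MvPolynomial (Fin 3) K}
    (hf : ∀ i, ∃ l l' h, l ∈ lineIdeal (v i) ∧ l' ∈ lineIdeal (v i) ∧ f = l * l' * h) :
    f ∈ symbolicPower (coneIdeal v) 2 := by
  rw [mem_symbolicPower_iff hv]
  intro i
  obtain ⟨s, hs, hs'⟩ := exists_separator hv i
  obtain ⟨l, l', h, hl, hl', rfl⟩ := hf i
  refine ⟨s * s, fun h => ((lineIdeal_isPrime (v i)).mem_or_mem h).elim hs hs, ?_⟩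
  have key : ∀ t ∈ lineIdeal (v i), s * t ∈ coneIdeal v := by
    refine fun t ht => mem_coneIdeal.2 fun j => ?_
    by_cases hj : j = i
    · subst hj; exact Ideal.mul_mem_left _ _ ht
    · exact Ideal.mul_mem_right _ _ (hs' j hj)
  have := Ideal.mul_mem_right h _ (Ideal.mul_mem_mul (key l hl) (key l' hl'))
  rw [sq]
  convert this using 1
  ring

end SymbolicPower

/-! ### Scaling and homogeneity of symbolic powers -/

/-- The substitution `X i ↦ c * X i`. -/
noncomputable def scale (c : K) : MvPolynomial (Fin 3) K →ₐ[K] MvPolynomial (Fin 3) K :=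
  aeval fun i => C c * X i

theorem eval_scale (c : K) (f : MvPolynomial (Fin 3) K) (x : Fin 3 → K) :
    eval x (scale c f) = eval (c • x) f := by
  induction f using MvPolynomial.induction_on with
  | C a => simp [scale]
  | add f g hf hg => simp [hf, hg]
  | mul_X f i hf => simp [hf]; simp [scale]

theorem scale_of_isHomogeneous {f : MvPolynomial (Fin 3) K} {d : ℕ} (hf : f.IsHomogeneous d)
    (c : K) : scale c f = c ^ d • f := by
  rw [scale, aeval_smul_of_isHomogeneous hf, aeval_X_left_apply, smul_eq_C_mul, C_pow]

section Scale

variable [Infinite K]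

theorem scale_mem_lineIdeal_iff {v : Fin 3 → K} {c : K} (hc : c ≠ 0)
    {f : MvPolynomial (Fin 3) K} : scale c f ∈ lineIdeal v ↔ f ∈ lineIdeal v := by
  constructor
  · intro h
    refine mem_lineIdeal_of_forall fun t _ => ?_
    have := eval_smul_eq_zero_of_mem_lineIdeal h (c⁻¹ * t)
    rwa [eval_scale, smul_smul, mul_inv_cancel_left₀ hc] at this
  · intro h
    refine mem_lineIdeal_of_forall fun t _ => ?_
    rw [eval_scale, smul_smul]
    exact eval_smul_eq_zero_of_mem_lineIdeal h _

theorem scale_mem_symbolicPower {ι : Type*} [Finite ι] {v : ι → Fin 3 → K} (hv : PairwiseIndep v)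
    {m : ℕ} {f : MvPolynomial (Fin 3) K} (hf : f ∈ symbolicPower (coneIdeal v) m) {c : K}
    (hc : c ≠ 0) : scale c f ∈ symbolicPower (coneIdeal v) m := by
  rw [mem_symbolicPower_iff hv] at *
  intro i
  obtain ⟨s, hs, hsf⟩ := hf i
  refine ⟨scale c s, fun h => hs ((scale_mem_lineIdeal_iff hc).1 h), ?_⟩
  rw [← map_mul]
  have h1 : (coneIdeal v).map (scale c) ≤ coneIdeal v :=
    Ideal.map_le_iff_le_comap.2 fun g hg => mem_coneIdeal.2 fun j =>
      (scale_mem_lineIdeal_iff hc).2 (mem_coneIdeal.1 hg j)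
  have h2 := Ideal.mem_map_of_mem (scale c) hsf
  rw [Ideal.map_pow] at h2
  exact Ideal.pow_right_mono h1 m h2

/-- An ideal over an infinite field that is stable under scaling is homogeneous. -/
theorem homogeneousComponent_mem_of_scale {J : Ideal (MvPolynomial (Fin 3) K)}
    (hJ : ∀ f ∈ J, ∀ c : K, c ≠ 0 → scale c f ∈ J) {f : MvPolynomial (Fin 3) K} (hf : f ∈ J)
    (k : ℕ) : homogeneousComponent k f ∈ J := by
  by_cases hk : f.totalDegree < k
  · rw [homogeneousComponent_eq_zero _ _ hk]; exact J.zero_mem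
  set W : Submodule K (MvPolynomial (Fin 3) K) := J.restrictScalars K
  suffices h : W.mkQ (homogeneousComponent k f) = 0 from (Submodule.Quotient.mk_eq_zero W).1 h
  -- Linear functionals separate the points of the quotient by `J`. Each one turns `c ↦ scale c f`
  -- into a polynomial in `c` with infinitely many roots, so every coefficient vanishes.
  rw [← Module.forall_dual_apply_eq_zero_iff K]
  intro φ
  let P : Polynomial K := ∑ j ∈ Finset.range (f.totalDegree + 1),
    Polynomial.monomial j (φ (W.mkQ (homogeneousComponent j f)))
  have hP : P = 0 := by
    refine Polynomial.eq_zero_of_infinite_isRoot _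
      ((Set.finite_singleton (0 : K)).infinite_compl.mono fun c hc => ?_)
    have h1 : W.mkQ (scale c f) = 0 :=
      (Submodule.Quotient.mk_eq_zero W).2 (hJ f hf c (by simpa using hc))
    have h2 : scale c f = ∑ j ∈ Finset.range (f.totalDegree + 1),
        c ^ j • homogeneousComponent j f := by
      conv_lhs => rw [← sum_homogeneousComponent f]
      rw [map_sum]
      exact Finset.sum_congr rfl fun j _ =>
        scale_of_isHomogeneous (homogeneousComponent_isHomogeneous _ _) _
    rw [h2] at h1
    have h3 := congrArg φ h1
    simp only [map_sum, map_smul, map_zero, smul_eq_mul] at h3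
    show Polynomial.eval c P = 0
    rw [← h3, Polynomial.eval_finsetSum]
    exact Finset.sum_congr rfl fun j _ => by rw [Polynomial.eval_monomial, mul_comm]
  have h4 : P.coeff k = φ (W.mkQ (homogeneousComponent k f)) := by
    simp only [P, Polynomial.finsetSum_coeff, Polynomial.coeff_monomial]
    rw [Finset.sum_ite_eq', if_pos (by simp; omega)]
  rw [← h4, hP, Polynomial.coeff_zero]

theorem homogeneousComponent_mem_symbolicPower {ι : Type*} [Finite ι] {v : ι → Fin 3 → K}
    (hv : PairwiseIndep v) {m : ℕ} {f : MvPolynomial (Fin 3) K}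
    (hf : f ∈ symbolicPower (coneIdeal v) m) (k : ℕ) :
    homogeneousComponent k f ∈ symbolicPower (coneIdeal v) m :=
  homogeneousComponent_mem_of_scale
    (fun _ hf _ hc => scale_mem_symbolicPower hv hf hc) hf k

end Scale

/-! ### Substitution: congruences, factors and degrees -/

theorem eval_aeval {σ τ : Type*} (φ : σ → MvPolynomial τ K) (f : MvPolynomial σ K) (x : τ → K) :
    eval x (aeval φ f) = eval (fun i => eval x (φ i)) f := by
  induction f using MvPolynomial.induction_on with
  | C a => simp
  | add f g hf hg => rw [map_add, map_add, map_add, hf, hg]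
  | mul_X f i hf => rw [map_mul, map_mul, map_mul, hf, aeval_X, eval_X]

theorem dvd_aeval_sub_aeval {σ A : Type*} [CommRing A] [Algebra K A] {φ ψ : σ → A} {D : A}
    (h : ∀ i, D ∣ φ i - ψ i) (f : MvPolynomial σ K) : D ∣ aeval φ f - aeval ψ f := by
  induction f using MvPolynomial.induction_on with
  | C a => simp
  | add f g hf hg => simpa [add_sub_add_comm] using dvd_add hf hg
  | mul_X f i hf =>
    have : aeval φ (f * X i) - aeval ψ (f * X i) =
        (aeval φ f - aeval ψ f) * φ i + aeval ψ f * (φ i - ψ i) := by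
      simp only [map_mul, aeval_X]; ring
    rw [this]
    exact dvd_add (Dvd.dvd.mul_right hf _) (Dvd.dvd.mul_left (h i) _)

theorem isHomogeneous_of_mul {σ : Type*} {D h : MvPolynomial σ K} {δ d : ℕ}
    (hD : D.IsHomogeneous δ) (hD0 : D ≠ 0) (hh : h ≠ 0) (hDh : (D * h).IsHomogeneous d) :
    ∃ k, d = δ + k ∧ h.IsHomogeneous k := by
  have key : ∀ k, D * homogeneousComponent k h = homogeneousComponent (δ + k) (D * h) := by
    intro k
    by_cases hk : h.totalDegree < k
    · rw [homogeneousComponent_eq_zero _ _ hk, homogeneousComponent_eq_zero, mul_zero]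
      refine (totalDegree_mul _ _).trans_lt ?_
      have := hD.totalDegree_le
      omega
    conv_rhs => rw [← sum_homogeneousComponent h, Finset.mul_sum, map_sum]
    rw [Finset.sum_eq_single_of_mem k (by simp; omega)]
    · rw [homogeneousComponent_eq_self (hD.mul (homogeneousComponent_isHomogeneous _ _))]
    · intro j _ hj
      rw [homogeneousComponent_of_mem (hD.mul (homogeneousComponent_isHomogeneous j h)),
        if_neg (by omega)]
  have h0 : ∀ k, δ + k ≠ d → homogeneousComponent k h = 0 := by
    intro k hk
    have := key k
    rw [homogeneousComponent_of_mem hDh, if_neg hk, mul_eq_zero] at this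
    exact this.resolve_left hD0
  have h1 : ∃ k, δ + k = d := by
    by_contra! hc
    refine hh ?_
    rw [← sum_homogeneousComponent h]
    exact Finset.sum_eq_zero fun k _ => h0 k (hc k)
  obtain ⟨k, rfl⟩ := h1
  refine ⟨k, rfl, ?_⟩
  have h2 : h = homogeneousComponent k h := by
    conv_lhs => rw [← sum_homogeneousComponent h]
    by_cases hk : h.totalDegree < k
    · rw [homogeneousComponent_eq_zero _ _ hk]
      refine Finset.sum_eq_zero fun j hj => h0 j ?_
      have := Finset.mem_range.1 hj
      omega
    · exact Finset.sum_eq_single_of_mem k (by simp; omega) fun j _ hj => h0 j (by omega)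
  rw [h2]
  exact homogeneousComponent_isHomogeneous _ _

theorem natDegree_prod_pow_le {σ : Type*} {Γ : σ → Polynomial K} {k : ℕ}
    (hΓ : ∀ i, (Γ i).natDegree ≤ k) (e : σ → ℕ) (s : Finset σ) :
    (∏ i ∈ s, Γ i ^ e i).natDegree ≤ k * ∑ i ∈ s, e i ∧
      (∏ i ∈ s, Γ i ^ e i).coeff (k * ∑ i ∈ s, e i) = ∏ i ∈ s, (Γ i).coeff k ^ e i := by
  classical
  induction s using Finset.induction_on with
  | empty => simp
  | insert i s hi ih =>
    have h1 : (Γ i ^ e i).natDegree ≤ k * e i :=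
      Polynomial.natDegree_pow_le_of_le _ (hΓ i) |>.trans (by rw [mul_comm])
    rw [Finset.prod_insert hi, Finset.sum_insert hi, Finset.prod_insert hi, mul_add]
    refine ⟨Polynomial.natDegree_mul_le_of_le h1 ih.1, ?_⟩
    rw [Polynomial.coeff_mul_add_eq_of_natDegree_le h1 ih.1, ih.2, mul_comm k,
      Polynomial.coeff_pow_of_natDegree_le (hΓ i)]

theorem natDegree_aeval_le {σ : Type*} {Γ : σ → Polynomial K} {k d : ℕ}
    (hΓ : ∀ i, (Γ i).natDegree ≤ k) {f : MvPolynomial σ K} (hf : f.IsHomogeneous d) :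
    (aeval Γ f).natDegree ≤ k * d := by
  rw [aeval_def, eval₂_eq]
  refine Polynomial.natDegree_sum_le_of_forall_le _ _ fun e he => ?_
  rw [Polynomial.algebraMap_eq, hf.degree_eq_sum_deg_support he]
  exact (Polynomial.natDegree_C_mul_le _ _).trans (natDegree_prod_pow_le hΓ e e.support).1

theorem coeff_aeval_top {σ : Type*} {Γ : σ → Polynomial K} {k d : ℕ}
    (hΓ : ∀ i, (Γ i).natDegree ≤ k) {f : MvPolynomial σ K} (hf : f.IsHomogeneous d) :
    (aeval Γ f).coeff (k * d) = eval (fun i => (Γ i).coeff k) f := by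
  rw [aeval_def, eval₂_eq, Polynomial.finsetSum_coeff, eval_eq]
  refine Finset.sum_congr rfl fun e he => ?_
  rw [Polynomial.algebraMap_eq, Polynomial.coeff_C_mul, hf.degree_eq_sum_deg_support he,
    (natDegree_prod_pow_le hΓ e e.support).2]

/-! ### Multiplicity at a point -/

/-- The Taylor expansion `f (x + T W)` of `f` at the point `x`, as a polynomial in `T`. -/
noncomputable def expandAt (x : Fin 3 → K) :
    MvPolynomial (Fin 3) K →ₐ[K] Polynomial (MvPolynomial (Fin 3) K) :=
  aeval fun i => Polynomial.C (C (x i)) + Polynomial.X * Polynomial.C (X i)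

/-- `f` vanishes to order at least `m` at the point `x`. -/
def HasMult (m : ℕ) (x : Fin 3 → K) (f : MvPolynomial (Fin 3) K) : Prop :=
  Polynomial.X ^ m ∣ expandAt x f

theorem coeff_zero_expandAt (x : Fin 3 → K) (f : MvPolynomial (Fin 3) K) :
    (expandAt x f).coeff 0 = C (eval x f) := by
  induction f using MvPolynomial.induction_on with
  | C a =>
    simp only [expandAt, algHom_C, eval_C]
    rw [Polynomial.algebraMap_apply, Polynomial.coeff_C_zero, algebraMap_eq]
  | add f g hf hg => simp [hf, hg]
  | mul_X f i hf =>
    rw [map_mul, Polynomial.mul_coeff_zero, hf]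
    simp [expandAt]

theorem X_dvd_expandAt_iff {x : Fin 3 → K} {f : MvPolynomial (Fin 3) K} :
    Polynomial.X ∣ expandAt x f ↔ eval x f = 0 := by
  rw [Polynomial.X_dvd_iff, coeff_zero_expandAt, map_eq_zero_iff _ (C_injective _ _)]

theorem HasMult.eval_eq_zero {m : ℕ} (hm : 0 < m) {x : Fin 3 → K} {f : MvPolynomial (Fin 3) K}
    (h : HasMult m x f) : eval x f = 0 :=
  X_dvd_expandAt_iff.1 ((dvd_pow_self _ hm.ne').trans h)

theorem hasMult_of_mem_pow {ι : Type*} {v : ι → Fin 3 → K} {m : ℕ} {f : MvPolynomial (Fin 3) K}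
    (hf : f ∈ coneIdeal v ^ m) (i : ι) (c : K) : HasMult m (c • v i) f := by
  have h1 : coneIdeal v ≤ (Ideal.span {Polynomial.X}).comap (expandAt (c • v i)) := by
    intro g hg
    rw [Ideal.mem_comap, Ideal.mem_span_singleton, X_dvd_expandAt_iff]
    exact eval_smul_eq_zero_of_mem_lineIdeal (mem_coneIdeal.1 hg i) c
  have h2 := (Ideal.pow_right_mono h1 m).trans (Ideal.le_comap_pow _ m) hf
  rwa [Ideal.mem_comap, Ideal.span_singleton_pow, Ideal.mem_span_singleton] at h2

/-- This is `f (c x + T W) = c ^ d * f (x + T (c⁻¹ W))`. It makes the multiplicity of a form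
independent of the homogeneous coordinates chosen for a point. -/
theorem expandAt_smul {f : MvPolynomial (Fin 3) K} {d : ℕ} (hf : f.IsHomogeneous d) {c : K}
    (hc : c ≠ 0) (x : Fin 3 → K) :
    expandAt (c • x) f = Polynomial.C (C c) ^ d *
      Polynomial.mapRingHom (scale c⁻¹ : MvPolynomial (Fin 3) K →ₐ[K] _).toRingHom
        (expandAt x f) := by
  have h1 : ∀ g : MvPolynomial (Fin 3) K,
      Polynomial.mapRingHom (scale c⁻¹ : MvPolynomial (Fin 3) K →ₐ[K] _).toRingHom
        (expandAt x g) = aeval (fun i => (Polynomial.C (C (x i)) +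
          Polynomial.X * Polynomial.C (C c⁻¹ * X i) : Polynomial (MvPolynomial (Fin 3) K))) g := by
    intro g
    induction g using MvPolynomial.induction_on with
    | C a =>
      simp only [expandAt, algHom_C]
      rw [Polynomial.algebraMap_apply]
      simp [scale]
    | add f g hf hg => rw [map_add, map_add, map_add, hf, hg]
    | mul_X f i hf =>
      rw [map_mul, map_mul, map_mul, hf]
      congr 1
      simp [expandAt, scale]
      ring
  rw [h1, ← aeval_smul_of_isHomogeneous hf, expandAt]
  congr 2
  funext i
  have h2 : (C c * C c⁻¹ : MvPolynomial (Fin 3) K) = 1 := by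
    rw [← C_mul, mul_inv_cancel₀ hc, C_1]
  have h3 : (Polynomial.C (C c) * Polynomial.C (C c⁻¹) :
      Polynomial (MvPolynomial (Fin 3) K)) = 1 := by
    rw [← Polynomial.C_mul, h2, Polynomial.C_1]
  simp only [Pi.smul_apply, smul_eq_mul, C_mul, Polynomial.C_mul]
  linear_combination (-Polynomial.X * Polynomial.C (X i)) * h3

theorem HasMult.smul {f : MvPolynomial (Fin 3) K} {d m : ℕ} (hf : f.IsHomogeneous d) {c : K}
    (hc : c ≠ 0) {x : Fin 3 → K} (h : HasMult m x f) : HasMult m (c • x) f := by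
  rw [HasMult, expandAt_smul hf hc]
  have := map_dvd (Polynomial.mapRingHom
    (scale c⁻¹ : MvPolynomial (Fin 3) K →ₐ[K] _).toRingHom) h
  rw [map_pow, Polynomial.coe_mapRingHom, Polynomial.map_X] at this
  exact Dvd.dvd.mul_left this _

theorem pow_sub_dvd_of_pow_dvd_mul {A : Type*} [CommRing A] [IsDomain A] {x a b : A}
    (hx : Prime x) {m e : ℕ} (hab : x ^ m ∣ a * b) (ha : ¬ x ^ (e + 1) ∣ a) : x ^ (m - e) ∣ b := by
  rw [pow_dvd_iff_le_emultiplicity, emultiplicity_mul hx] at hab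
  rw [pow_dvd_iff_le_emultiplicity] at ha ⊢
  have ha' : emultiplicity x a ≤ e := by
    rw [not_le] at ha
    exact Order.le_of_lt_add_one (by exact_mod_cast ha)
  have h2 : (m : ℕ∞) ≤ e + emultiplicity x b := hab.trans (by gcongr)
  rw [ENat.natCast_sub]
  exact tsub_le_iff_left.2 h2

theorem HasMult.of_mul {m e : ℕ} {x : Fin 3 → K} {D f : MvPolynomial (Fin 3) K}
    (h : HasMult m x (D * f)) (hD : ¬ HasMult (e + 1) x D) : HasMult (m - e) x f := by
  rw [HasMult, map_mul] at h
  exact pow_sub_dvd_of_pow_dvd_mul Polynomial.prime_X h hD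

/-- `f` vanishes to order at least `m` at all the points of the family `v`. -/
def FatVanishing {ι : Type*} (v : ι → Fin 3 → K) (m : ℕ) (f : MvPolynomial (Fin 3) K) : Prop :=
  ∀ i, ∀ c : K, c ≠ 0 → HasMult m (c • v i) f

theorem fatVanishing_of_mem_symbolicPower [Infinite K] {ι : Type*} [Finite ι] {v : ι → Fin 3 → K}
    (hv : PairwiseIndep v) {m d : ℕ} {f : MvPolynomial (Fin 3) K} (hd : f.IsHomogeneous d)
    (hf : f ∈ symbolicPower (coneIdeal v) m) : FatVanishing v m f := by
  intro i c hc
  obtain ⟨s, hs, hsf⟩ := (mem_symbolicPower_iff hv).1 hf i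
  -- The multiplier `s` need not be homogeneous and may vanish at `v i` itself. It is nonzero at
  -- some other multiple, where it can be cancelled; homogeneity of `f` then moves the multiplicity
  -- to every multiple.
  obtain ⟨c', hc', hs'⟩ : ∃ c' : K, c' ≠ 0 ∧ eval (c' • v i) s ≠ 0 := by
    by_contra! h
    exact hs (mem_lineIdeal_of_forall h)
  have h1 := (hasMult_of_mem_pow hsf i c').of_mul (e := 0)
    (by rwa [HasMult, zero_add, pow_one, X_dvd_expandAt_iff])
  have h2 := h1.smul hd (mul_ne_zero hc (inv_ne_zero hc'))
  rwa [smul_smul, inv_mul_cancel_right₀ hc'] at h2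

theorem FatVanishing.eval_eq_zero {ι : Type*} {v : ι → Fin 3 → K} {m d : ℕ}
    {f : MvPolynomial (Fin 3) K} (h : FatVanishing v m f) (hd : f.IsHomogeneous d) (hm : 0 < m)
    (i : ι) (c : K) : eval (c • v i) f = 0 := by
  rw [eval_smul_of_isHomogeneous hd]
  have := (h i 1 one_ne_zero).eval_eq_zero hm
  rw [one_smul] at this
  rw [this, mul_zero]

/-- Order of vanishing along a parametrized curve. -/
theorem HasMult.dvd_aeval {m : ℕ} {f : MvPolynomial (Fin 3) K} {Γ : Fin 3 → Polynomial K} {t : K}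
    (h : HasMult m (fun i => (Γ i).eval t) f) :
    (Polynomial.X - Polynomial.C t) ^ m ∣ aeval Γ f := by
  have h1 : ∀ i, ∃ w, Γ i - Polynomial.C ((Γ i).eval t) = (Polynomial.X - Polynomial.C t) * w :=
    fun i => Polynomial.X_sub_C_dvd_sub_C_eval
  choose w hw using h1
  -- Specializing the Taylor variable `T` to `X - t` and `W` to the difference quotients `w` of the
  -- path turns the expansion of `g` into `g ∘ Γ`.
  let Ξ : Polynomial (MvPolynomial (Fin 3) K) →+* Polynomial K :=
    Polynomial.eval₂RingHom (aeval w : MvPolynomial (Fin 3) K →ₐ[K] Polynomial K).toRingHom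
      (Polynomial.X - Polynomial.C t)
  have h2 : ∀ g : MvPolynomial (Fin 3) K,
      Ξ (expandAt (fun i => (Γ i).eval t) g) = aeval Γ g := by
    intro g
    induction g using MvPolynomial.induction_on with
    | C a =>
      simp only [expandAt, algHom_C]
      rw [Polynomial.algebraMap_apply]
      simp [Ξ]
    | add f g hf hg => rw [map_add, map_add, map_add, hf, hg]
    | mul_X f i hf =>
      rw [map_mul, map_mul, map_mul, hf]
      congr 1
      have := hw i
      simp [expandAt, Ξ, Polynomial.algebraMap_eq]
      linear_combination -this
  have h3 := map_dvd Ξ h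
  rw [h2, map_pow] at h3
  simpa [Ξ] using h3

/-- A form of degree `d` that vanishes to order `m` at `n` points of a curve parametrized in degree
`k` vanishes on this curve if `k * d < n * m`. -/
theorem aeval_path_eq_zero {ι : Type*} [Fintype ι] {v : ι → Fin 3 → K} (hv : PairwiseIndep v)
    {m d k : ℕ} {f : MvPolynomial (Fin 3) K} (hd : f.IsHomogeneous d) (hf : FatVanishing v m f)
    {Γ : Fin 3 → Polynomial K} (hΓ : ∀ j, (Γ j).natDegree ≤ k)
    (hpts : ∀ i, ∃ t c : K, c ≠ 0 ∧ (fun j => (Γ j).eval t) = c • v i)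
    (hlt : k * d < Fintype.card ι * m) : aeval Γ f = 0 := by
  choose t c hc ht using hpts
  -- Distinct points of the plane are reached at distinct parameters, so the factors `(X - t i) ^ m`
  -- are coprime.
  have hinj : Function.Injective t := by
    intro i j hij
    by_contra hne
    obtain ⟨w, hw⟩ := hv i j hne
    have h1 : c i • v i = c j • v j := by rw [← ht i, ← ht j, hij]
    have h2 : c i * det3 (v i) (v j) w = 0 := by
      have e : ∀ l, c i * v i l = c j * v j l := fun l => congrFun h1 l
      simp only [det3]
      linear_combination (v j 2 * w 0 - v j 0 * w 2) * e 1 + (v j 0 * w 1 - v j 1 * w 0) * e 2 +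
        (v j 1 * w 2 - v j 2 * w 1) * e 0
    rw [hw, mul_one] at h2
    exact hc i h2
  have hdvd : ∏ i, (Polynomial.X - Polynomial.C (t i)) ^ m ∣ aeval Γ f := by
    refine Finset.prod_dvd_of_coprime (fun i _ j _ hij =>
      (Polynomial.pairwise_coprime_X_sub_C hinj hij).pow) fun i _ => ?_
    refine HasMult.dvd_aeval ?_
    rw [ht i]
    exact hf i _ (hc i)
  by_contra hne
  have h1 := Polynomial.natDegree_le_of_dvd hdvd hne
  rw [Polynomial.natDegree_prod_of_monic _ _
    fun i _ => (Polynomial.monic_X_sub_C (t i)).pow m] at h1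
  simp only [Polynomial.natDegree_pow, Polynomial.natDegree_X_sub_C, mul_one, Finset.sum_const,
    smul_eq_mul, Finset.card_univ] at h1
  have := natDegree_aeval_le hΓ hd
  omega

/-! ### Lines -/

theorem det3_smul_eq (p q w x : Fin 3 → K) :
    det3 p q w • x = det3 x q w • p + det3 p x w • q + det3 p q x • w := by
  funext i
  simp only [Pi.smul_apply, Pi.add_apply, smul_eq_mul, det3]
  fin_cases i <;> simp only [Fin.zero_eta, Fin.mk_one, Fin.reduceFinMk] <;> ring

theorem exists_eq_add_of_det3_eq_zero {p q w x : Fin 3 → K} (hw : det3 p q w = 1)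
    (hx : det3 p q x = 0) : ∃ s t : K, x = s • p + t • q := by
  refine ⟨det3 x q w, det3 p x w, ?_⟩
  have := det3_smul_eq p q w x
  rwa [hw, hx, one_smul, zero_smul, add_zero] at this

@[simp]
theorem det3_self_right (p q : Fin 3 → K) : det3 p q q = 0 := by
  simp only [det3]; ring

@[simp]
theorem det3_self_left (p q : Fin 3 → K) : det3 p q p = 0 := by
  simp only [det3]; ring

theorem det3_smul_right (p q x : Fin 3 → K) (c : K) : det3 p q (c • x) = c * det3 p q x := by
  simp only [det3, Pi.smul_apply, smul_eq_mul]; ring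

theorem det3_add (p q x y : Fin 3 → K) : det3 p q (x + y) = det3 p q x + det3 p q y := by
  simp only [det3, Pi.add_apply]; ring

theorem lineForm_ne_zero {p q w : Fin 3 → K} (hw : det3 p q w = 1) : lineForm p q ≠ 0 := by
  intro h
  have := eval_lineForm p q w
  rw [h, hw, map_zero] at this
  exact zero_ne_one this

/-- The projection from the point `w` to the line through `p` and `q`. -/
noncomputable def lineProj (p q w : Fin 3 → K) :
    MvPolynomial (Fin 3) K →ₐ[K] MvPolynomial (Fin 3) K :=
  aeval fun i => X i - C (w i) * lineForm p q

/-- The projection is the identity modulo the linear form, and it kills this form because `w` is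
normalized by `det3 p q w = 1`. Primality of the form follows, since its multiples are the kernel of
a map to a domain. -/
theorem lineForm_dvd_iff {p q w : Fin 3 → K} (hw : det3 p q w = 1) {f : MvPolynomial (Fin 3) K} :
    lineForm p q ∣ f ↔ lineProj p q w f = 0 := by
  constructor
  · have h0 : lineProj p q w (lineForm p q) = 0 := by
      have h1 : lineProj p q w (lineForm p q) =
          lineForm p q - C (det3 p q w) * lineForm p q := by
        have h2 : lineForm p q = C (p 1 * q 2 - p 2 * q 1) * X 0 +
          C (p 2 * q 0 - p 0 * q 2) * X 1 + C (p 0 * q 1 - p 1 * q 0) * X 2 := rfl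
        conv_lhs => rw [h2]
        simp only [lineProj, map_add, map_mul, aeval_X, algHom_C, algebraMap_eq, det3]
        linear_combination -h2
      rw [h1, hw, C_1, one_mul, sub_self]
    rintro ⟨g, rfl⟩
    rw [map_mul, h0, zero_mul]
  · intro h
    have h1 : lineForm p q ∣ aeval X f - lineProj p q w f :=
      dvd_aeval_sub_aeval (fun i => by simp) f
    rwa [aeval_X_left_apply, h, sub_zero] at h1

theorem prime_lineForm {p q w : Fin 3 → K} (hw : det3 p q w = 1) : Prime (lineForm p q) := by
  refine ⟨lineForm_ne_zero hw, fun h => ?_, fun a b hab => ?_⟩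
  · have := h.map (eval p)
    rw [eval_lineForm, det3_self_left] at this
    exact not_isUnit_zero this
  · rw [lineForm_dvd_iff hw, map_mul, mul_eq_zero] at hab
    exact hab.imp (lineForm_dvd_iff hw).2 (lineForm_dvd_iff hw).2

theorem lineForm_dvd_of_forall [Infinite K] {p q w : Fin 3 → K} (hw : det3 p q w = 1)
    {f : MvPolynomial (Fin 3) K} (hf : ∀ s t : K, eval (s • p + t • q) f = 0) :
    lineForm p q ∣ f := by
  rw [lineForm_dvd_iff hw]
  refine MvPolynomial.funext fun x => ?_
  rw [lineProj, eval_aeval, map_zero, ← hf (det3 x q w) (det3 p x w)]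
  have h := det3_smul_eq p q w x
  rw [hw, one_smul] at h
  congr 2
  funext i
  have := congrFun h i
  simp only [Pi.add_apply, Pi.smul_apply, smul_eq_mul] at this
  simp only [map_sub, map_mul, eval_X, eval_C, eval_lineForm, Pi.add_apply, Pi.smul_apply,
    smul_eq_mul]
  linear_combination this

/-- Bézout for a line: two points of multiplicity `m` on it force a form of degree less than `2 * m`
to contain it. -/
theorem lineForm_dvd_of_fatVanishing [Infinite K] {ι : Type*} {v : ι → Fin 3 → K}
    (hv : PairwiseIndep v) {i j : ι} (hij : i ≠ j) {m d : ℕ} {f : MvPolynomial (Fin 3) K}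
    (hd : f.IsHomogeneous d) (hf : FatVanishing v m f) (hlt : d < 2 * m) :
    lineForm (v i) (v j) ∣ f := by
  obtain ⟨w, hw⟩ := hv i j hij
  refine lineForm_dvd_of_forall hw fun s t => ?_
  have hm : 0 < m := by omega
  by_cases hs : s = 0
  · rw [hs, zero_smul, zero_add]; exact hf.eval_eq_zero hd hm _ _
  by_cases ht : t = 0
  · rw [ht, zero_smul, add_zero]; exact hf.eval_eq_zero hd hm _ _
  let σ : Bool → ι := fun b => if b then i else j
  have hσ : Function.Injective σ := by
    intro a b; cases a <;> cases b <;> simp [σ, hij, hij.symm]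
  -- The target `s • v i + t • v j` is put at parameter infinity: it is the leading coefficient of
  -- the path, which meets the two points at the parameters `0` and `-1`.
  let Γ : Fin 3 → Polynomial K := fun l =>
    Polynomial.C (s * v i l + t * v j l) * Polynomial.X + Polynomial.C (s * v i l)
  have hΓ : ∀ l, (Γ l).natDegree ≤ 1 := fun l => Polynomial.natDegree_linear_le
  have h0 : aeval Γ f = 0 := by
    refine aeval_path_eq_zero (v := fun b => v (σ b)) (fun a b hab => hv _ _ (hσ.ne hab)) hd
      (fun b c hc => hf (σ b) c hc) hΓ ?_ (by simpa using hlt)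
    rintro (_ | _)
    · refine ⟨-1, -t, neg_ne_zero.2 ht, funext fun l => ?_⟩
      simp [Γ, σ]
    · refine ⟨0, s, hs, funext fun l => ?_⟩
      simp [Γ, σ]
  have h1 := coeff_aeval_top hΓ hd
  rw [h0, Polynomial.coeff_zero] at h1
  rw [h1]
  congr 2
  funext l
  simp [Γ]

/-- A line is smooth: the coefficient of `T` in its Taylor expansion is the nonzero linear form
itself, so it accounts for at most one order of vanishing. -/
theorem HasMult.of_lineForm_mul {m : ℕ} {x p q w : Fin 3 → K} (hw : det3 p q w = 1)
    {f : MvPolynomial (Fin 3) K} (h : HasMult m x (lineForm p q * f)) : HasMult (m - 1) x f := by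
  refine h.of_mul fun h2 => lineForm_ne_zero hw ?_
  have h3 := (Polynomial.X_pow_dvd_iff.1 h2) 1 (by norm_num)
  have h4 : expandAt x (lineForm p q) =
      Polynomial.C (C (det3 p q x)) + Polynomial.C (lineForm p q) * Polynomial.X := by
    rw [lineForm, det3]
    simp only [expandAt, map_add, map_mul, aeval_X, algHom_C, Polynomial.algebraMap_apply,
      algebraMap_eq]
    ring
  rw [h4, Polynomial.coeff_add, Polynomial.coeff_C_mul, Polynomial.coeff_X_one, mul_one,
    Polynomial.coeff_C_of_ne_zero one_ne_zero, zero_add] at h3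
  exact h3

theorem HasMult.of_mul_of_eval_ne_zero {m : ℕ} {x : Fin 3 → K} {D f : MvPolynomial (Fin 3) K}
    (hD : eval x D ≠ 0) (h : HasMult m x (D * f)) : HasMult m x f :=
  h.of_mul (e := 0) (by rwa [HasMult, zero_add, pow_one, X_dvd_expandAt_iff])

/-! ### Conics -/

/-- The quadratic form with matrix `M`. -/
noncomputable def quadForm (M : Fin 3 → Fin 3 → K) : MvPolynomial (Fin 3) K :=
  ∑ i, ∑ j, C (M i j) * (X i * X j)

/-- The polar bilinear form of the quadratic form with matrix `M`. -/
def polar (M : Fin 3 → Fin 3 → K) (p x : Fin 3 → K) : K :=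
  ∑ j, (∑ i, (M i j + M j i) * p i) * x j

/-- The linear form `x ↦ polar M p x`. -/
noncomputable def polarForm (M : Fin 3 → Fin 3 → K) (p : Fin 3 → K) : MvPolynomial (Fin 3) K :=
  ∑ j, C (∑ i, (M i j + M j i) * p i) * X j

theorem eval_polarForm (M : Fin 3 → Fin 3 → K) (p x : Fin 3 → K) :
    eval x (polarForm M p) = polar M p x := by
  simp [polarForm, polar]

theorem isHomogeneous_polarForm (M : Fin 3 → Fin 3 → K) (p : Fin 3 → K) :
    (polarForm M p).IsHomogeneous 1 :=
  IsHomogeneous.sum _ _ _ fun _ _ => isHomogeneous_C_mul_X _ _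

theorem eval_quadForm_add (M : Fin 3 → Fin 3 → K) (p q : Fin 3 → K) (s t : K) :
    eval (s • p + t • q) (quadForm M) =
      s ^ 2 * eval p (quadForm M) + s * t * polar M p q + t ^ 2 * eval q (quadForm M) := by
  simp only [quadForm, polar, Fin.sum_univ_three, map_add, map_mul, eval_C, eval_X, Pi.add_apply,
    Pi.smul_apply, smul_eq_mul]
  ring

theorem polar_add_smul (M : Fin 3 → Fin 3 → K) (p x y : Fin 3 → K) (s t : K) :
    polar M p (s • x + t • y) = s * polar M p x + t * polar M p y := by
  simp only [polar, Fin.sum_univ_three, Pi.add_apply, Pi.smul_apply, smul_eq_mul]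
  ring

theorem polar_self (M : Fin 3 → Fin 3 → K) (p : Fin 3 → K) :
    polar M p p = 2 * eval p (quadForm M) := by
  simp only [quadForm, polar, Fin.sum_univ_three, map_add, map_mul, eval_C, eval_X]
  ring

theorem exists_eq_quadForm {f : MvPolynomial (Fin 3) K} (hf : f.IsHomogeneous 2) :
    ∃ M, f = quadForm M := by
  classical
  have h : f ∈ homogeneousSubmodule (Fin 3) K 2 := hf
  rw [← homogeneousSubmodule_one_pow, homogeneousSubmodule_one_eq_span_X, sq,
    Submodule.span_mul_span] at h
  clear hf
  induction h using Submodule.span_induction with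
  | mem x hx =>
    obtain ⟨_, ⟨i, rfl⟩, _, ⟨j, rfl⟩, rfl⟩ := hx
    refine ⟨fun a b => if a = i ∧ b = j then 1 else 0, ?_⟩
    rw [quadForm, Finset.sum_eq_single i, Finset.sum_eq_single j]
    · simp
    · intro b _ hb; simp [hb]
    · simp
    · intro b _ hb; simp [hb]
    · simp
  | zero => exact ⟨0, by simp [quadForm]⟩
  | add x y _ _ hx hy =>
    obtain ⟨M, rfl⟩ := hx
    obtain ⟨N, rfl⟩ := hy
    exact ⟨M + N, by simp [quadForm, add_mul, Finset.sum_add_distrib]⟩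
  | smul a x _ hx =>
    obtain ⟨M, rfl⟩ := hx
    exact ⟨a • M, by simp [quadForm, Finset.mul_sum, smul_eq_C_mul, mul_assoc]⟩

/-- On the line through two points of the conic, the quadratic form is `s * t * polar M p q`. If
this vanished, the line would be a component of an irreducible conic. -/
theorem polar_ne_zero [Infinite K] {M : Fin 3 → Fin 3 → K} (hirr : Irreducible (quadForm M))
    (hhom : (quadForm M).IsHomogeneous 2)
    {p q w : Fin 3 → K} (hw : det3 p q w = 1) (hp : eval p (quadForm M) = 0)
    (hq : eval q (quadForm M) = 0) : polar M p q ≠ 0 := by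
  intro h0
  obtain ⟨g, hg⟩ := lineForm_dvd_of_forall (f := quadForm M) hw fun s t => by
    rw [eval_quadForm_add, hp, hq, h0]; ring
  rcases hirr.isUnit_or_isUnit hg with h | h
  · exact (prime_lineForm hw).not_isUnit h
  · obtain ⟨c, hc, rfl⟩ := isUnit_iff_eq_C_of_isReduced.1 h
    rw [mul_comm] at hg
    have := (isHomogeneous_lineForm p q).C_mul c
    rw [← hg] at this
    exact absurd (this.inj_right hhom hirr.ne_zero) (by norm_num)

theorem not_collinear [Infinite K] {M : Fin 3 → Fin 3 → K} (hirr : Irreducible (quadForm M))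
    (hhom : (quadForm M).IsHomogeneous 2) {ι : Type*} {v : ι → Fin 3 → K} (hv : PairwiseIndep v)
    (hC : ∀ i, eval (v i) (quadForm M) = 0) {i j k : ι} (hij : i ≠ j) (hik : i ≠ k)
    (hjk : j ≠ k) : det3 (v i) (v j) (v k) ≠ 0 := by
  intro h0
  obtain ⟨w, hw⟩ := hv i j hij
  obtain ⟨s, t, hst⟩ := exists_eq_add_of_det3_eq_zero hw h0
  have h1 := hC k
  rw [hst, eval_quadForm_add, hC, hC] at h1
  simp only [mul_zero, add_zero, zero_add, mul_eq_zero, polar_ne_zero hirr hhom hw (hC i) (hC j),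
    or_false] at h1
  rcases h1 with rfl | rfl
  · obtain ⟨w', hw'⟩ := hv j k hjk
    rw [hst] at hw'
    refine zero_ne_one (hw'.symm.trans ?_).symm
    simp only [det3, Pi.add_apply, Pi.smul_apply, smul_eq_mul]; ring
  · obtain ⟨w', hw'⟩ := hv i k hik
    rw [hst] at hw'
    refine zero_ne_one (hw'.symm.trans ?_).symm
    simp only [det3, Pi.add_apply, Pi.smul_apply, smul_eq_mul]; ring

/-- The map `x ↦ polar M p x • x - Q x • p` is the projection to the conic `Q = 0` from its point
`p`, giving the second intersection with the line through `p` and `x`. Modulo `Q` it is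
multiplication by a linear form, so `Q` divides `polarForm M p ^ d * f`; a prime of degree 2 does
not divide the nonzero linear factor. No rational normal form of the conic is needed. -/
theorem quadForm_dvd_of_forall [Infinite K] {M : Fin 3 → Fin 3 → K}
    (hirr : Irreducible (quadForm M)) (hhom : (quadForm M).IsHomogeneous 2) {p q : Fin 3 → K}
    (hpq : polar M p q ≠ 0) {f : MvPolynomial (Fin 3) K} {d : ℕ} (hd : f.IsHomogeneous d)
    (hf : ∀ x, eval (polar M p x • x - eval x (quadForm M) • p) f = 0) : quadForm M ∣ f := by
  have h0 : aeval (fun i => polarForm M p * X i - C (p i) * quadForm M) f = 0 := by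
    refine MvPolynomial.funext fun x => ?_
    rw [eval_aeval, map_zero, ← hf x]
    congr 2
    funext i
    simp [eval_polarForm, mul_comm]
  have h1 : quadForm M ∣ aeval (fun i => polarForm M p * X i) f -
      aeval (fun i => polarForm M p * X i - C (p i) * quadForm M) f :=
    dvd_aeval_sub_aeval (fun i => by simp) f
  rw [h0, sub_zero, aeval_smul_of_isHomogeneous hd, aeval_X_left_apply] at h1
  refine (hirr.prime.dvd_or_dvd h1).resolve_left fun h2 => ?_
  obtain ⟨g, hg⟩ := hirr.prime.dvd_of_dvd_pow h2
  have hne : polarForm M p ≠ 0 := fun h => hpq (by rw [← eval_polarForm, h, map_zero])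
  have hg0 : g ≠ 0 := by rintro rfl; exact hne (by rw [hg, mul_zero])
  have h3 := (isHomogeneous_polarForm M p).totalDegree hne
  rw [hg, totalDegree_mul_of_isDomain hirr.ne_zero hg0, hhom.totalDegree hirr.ne_zero] at h3
  omega

/-- Bézout for the conic: a form of degree `d` restricts to degree `2 * d` on a quadratic
parametrization, which is too small for `m`-fold zeros at all the points. -/
theorem quadForm_dvd_of_fatVanishing [Infinite K] {M : Fin 3 → Fin 3 → K}
    (hirr : Irreducible (quadForm M)) (hhom : (quadForm M).IsHomogeneous 2) {ι : Type*} [Fintype ι]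
    [Nontrivial ι] {v : ι → Fin 3 → K} (hv : PairwiseIndep v)
    (hC : ∀ i, eval (v i) (quadForm M) = 0) {m d : ℕ} {f : MvPolynomial (Fin 3) K}
    (hd : f.IsHomogeneous d) (hf : FatVanishing v m f) (hlt : 2 * d < Fintype.card ι * m) :
    quadForm M ∣ f := by
  obtain ⟨o, n, hon⟩ := exists_pair_ne ι
  have hm : 0 < m := Nat.pos_of_ne_zero (by rintro rfl; omega)
  have hpol : ∀ i, i ≠ o → polar M (v o) (v i) ≠ 0 := by
    intro i hi
    obtain ⟨w, hw⟩ := hv o i hi.symm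
    exact polar_ne_zero hirr hhom hw (hC o) (hC i)
  have hself : polar M (v o) (v o) = 0 := by rw [polar_self, hC, mul_zero]
  refine quadForm_dvd_of_forall hirr hhom (hpol n hon.symm) hd fun x => ?_
  -- the map `x ↦ polar M (v o) x • x - eval x (quadForm M) • v o` on the span of `v o` and `v i`
  have hproj : ∀ (i : ι) (s t : K), polar M (v o) (s • v o + t • v i) • (s • v o + t • v i) -
      eval (s • v o + t • v i) (quadForm M) • v o = (t ^ 2 * polar M (v o) (v i)) • v i := by
    intro i s t
    rw [polar_add_smul, hself, eval_quadForm_add, hC, hC]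
    funext l
    simp only [Pi.sub_apply, Pi.add_apply, Pi.smul_apply, smul_eq_mul]
    ring
  by_cases hx0 : polar M (v o) x = 0
  · rw [hx0, zero_smul, zero_sub, ← neg_smul]
    exact hf.eval_eq_zero hd hm _ _
  by_cases hxi : ∃ i, i ≠ o ∧ det3 (v o) (v i) x = 0
  · obtain ⟨i, hi, hix⟩ := hxi
    obtain ⟨w, hw⟩ := hv o i hi.symm
    obtain ⟨s, t, rfl⟩ := exists_eq_add_of_det3_eq_zero hw hix
    rw [hproj]
    exact hf.eval_eq_zero hd hm _ _
  push Not at hxi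
  -- Projecting the line through `x` and `v n` to the conic from `v o` gives a quadratic path. The
  -- point `x` sits at parameter infinity, so its image is read off from the leading coefficient.
  let Λ : Fin 3 → Polynomial K := fun l => Polynomial.C (x l) * Polynomial.X + Polynomial.C (v n l)
  let Γ : Fin 3 → Polynomial K := fun l => aeval Λ (polarForm M (v o)) * Λ l -
    Polynomial.C (v o l) * aeval Λ (quadForm M)
  have hΛ : ∀ l, (Λ l).natDegree ≤ 1 := fun l => Polynomial.natDegree_linear_le
  have h1 : (aeval Λ (polarForm M (v o))).natDegree ≤ 1 :=
    natDegree_aeval_le hΛ (isHomogeneous_polarForm M (v o))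
  have h2 : (aeval Λ (quadForm M)).natDegree ≤ 2 := natDegree_aeval_le hΛ hhom
  have hΓ : ∀ l, (Γ l).natDegree ≤ 2 := fun l =>
    Polynomial.natDegree_sub_le_of_le (Polynomial.natDegree_mul_le_of_le h1 (hΛ l))
      ((Polynomial.natDegree_C_mul_le _ _).trans h2)
  have hΛt : ∀ t : K, (fun l => (Λ l).eval t) = (1 : K) • v n + t • x := by
    intro t; funext l; simp [Λ]; ring
  have hΓt : ∀ t : K, (fun l => (Γ l).eval t) =
      polar M (v o) ((1 : K) • v n + t • x) • ((1 : K) • v n + t • x) -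
        eval ((1 : K) • v n + t • x) (quadForm M) • v o := by
    intro t
    funext l
    simp only [Γ, Polynomial.eval_sub, Polynomial.eval_mul, Polynomial.eval_C,
      polynomial_eval_aeval, hΛt, eval_polarForm, Pi.sub_apply, Pi.smul_apply, smul_eq_mul]
    rw [show (Λ l).eval t = ((1 : K) • v n + t • x) l from congrFun (hΛt t) l]
    simp only [Pi.add_apply, Pi.smul_apply, smul_eq_mul]
    ring
  have hindep : ∀ t : K, det3 (v o) ((1 : K) • v n + t • x) x ≠ 0 := by
    intro t h
    refine hxi n hon.symm ?_
    rw [← h]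
    simp only [det3, Pi.add_apply, Pi.smul_apply, smul_eq_mul]
    ring
  have hpolar : ∀ i, polar M (v i) x ≠ 0 → polar M (v i) ((1 : K) • v n +
      (-polar M (v i) (v n) / polar M (v i) x) • x) = 0 := by
    intro i hi
    rw [polar_add_smul, div_mul_cancel₀ _ hi]
    ring
  -- The path reaches `v o` where `Λ` crosses the tangent at `v o`, and any other `v i` where `Λ`
  -- crosses the line through `v o` and `v i`. The cases excluded above ensure that these parameters
  -- are finite.
  have hpts : ∀ i, ∃ t c : K, c ≠ 0 ∧ (fun l => (Γ l).eval t) = c • v i := by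
    intro i
    by_cases hi : i = o
    · subst hi
      refine ⟨-polar M (v i) (v n) / polar M (v i) x, -eval ((1 : K) • v n +
        (-polar M (v i) (v n) / polar M (v i) x) • x) (quadForm M), ?_, ?_⟩
      · refine neg_ne_zero.2 fun hQ => ?_
        refine polar_ne_zero hirr hhom (w := (det3 (v i) ((1 : K) • v n + (-polar M (v i) (v n) /
          polar M (v i) x) • x) x)⁻¹ • x) ?_ (hC i) hQ (hpolar i hx0)
        rw [det3_smul_right, inv_mul_cancel₀ (hindep _)]
      · rw [hΓt, hpolar i hx0, zero_smul, zero_sub, neg_smul]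
    · have hdet : det3 (v o) (v i) ((1 : K) • v n +
          (-det3 (v o) (v i) (v n) / det3 (v o) (v i) x) • x) = 0 := by
        rw [det3_add, det3_smul_right, det3_smul_right, div_mul_cancel₀ _ (hxi i hi)]
        ring
      obtain ⟨w, hw⟩ := hv o i (Ne.symm hi)
      obtain ⟨s, t, hst⟩ := exists_eq_add_of_det3_eq_zero hw hdet
      refine ⟨_, t ^ 2 * polar M (v o) (v i), mul_ne_zero (pow_ne_zero 2 ?_) (hpol i hi),
        by rw [hΓt, hst, hproj]⟩
      rintro rfl
      refine hindep (-det3 (v o) (v i) (v n) / det3 (v o) (v i) x) ?_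
      rw [hst]
      simp only [det3, Pi.add_apply, Pi.smul_apply, smul_eq_mul]
      ring
  have h0 : aeval Γ f = 0 := aeval_path_eq_zero hv hd hf hΓ hpts hlt
  have h3 := coeff_aeval_top hΓ hd
  rw [h0, Polynomial.coeff_zero] at h3
  rw [h3]
  congr 2
  funext l
  have h4 : (aeval Λ (polarForm M (v o))).coeff 1 = polar M (v o) x := by
    have := coeff_aeval_top hΛ (isHomogeneous_polarForm M (v o))
    rw [mul_one] at this
    rw [this, ← eval_polarForm]
    congr 2
    funext l
    simp [Λ]
  have h5 : (aeval Λ (quadForm M)).coeff 2 = eval x (quadForm M) := by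
    have := coeff_aeval_top hΛ hhom
    rw [one_mul] at this
    rw [this]
    congr 2
    funext l
    simp [Λ]
  have h6 : (Λ l).coeff 1 = x l := by simp [Λ]
  simp only [Γ, Polynomial.coeff_sub, Polynomial.coeff_C_mul, h5, Pi.sub_apply, Pi.smul_apply,
    smul_eq_mul]
  rw [show (2 : ℕ) = 1 + 1 from rfl, Polynomial.coeff_mul_add_eq_of_natDegree_le h1 (hΛ l), h4, h6]
  ring

/-! ### Restriction to a line: the lower bound on degrees -/

/-- The restriction of a polynomial to the line `t ↦ t • a + b`. -/
noncomputable def res (a b : Fin 3 → K) : MvPolynomial (Fin 3) K →ₐ[K] Polynomial K :=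
  aeval fun i => Polynomial.C (a i) * Polynomial.X + Polynomial.C (b i)

theorem natDegree_res_le (a b : Fin 3 → K) {f : MvPolynomial (Fin 3) K} {d : ℕ}
    (hf : f.IsHomogeneous d) : (res a b f).natDegree ≤ d := by
  simpa [res] using natDegree_aeval_le (k := 1) (fun i => Polynomial.natDegree_linear_le) hf

theorem coeff_res (a b : Fin 3 → K) {f : MvPolynomial (Fin 3) K} {d : ℕ}
    (hf : f.IsHomogeneous d) : (res a b f).coeff d = eval a f := by
  have := coeff_aeval_top (Γ := fun i => Polynomial.C (a i) * Polynomial.X + Polynomial.C (b i))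
    (k := 1) (fun i => Polynomial.natDegree_linear_le) hf
  simpa [res] using this

theorem natDegree_res {a b : Fin 3 → K} {f : MvPolynomial (Fin 3) K} {d : ℕ}
    (hf : f.IsHomogeneous d) (ha : eval a f ≠ 0) : (res a b f).natDegree = d :=
  Polynomial.natDegree_eq_of_le_of_coeff_ne_zero (natDegree_res_le a b hf)
    (by rwa [coeff_res a b hf])

theorem eval_res (a b : Fin 3 → K) (f : MvPolynomial (Fin 3) K) (t : K) :
    (res a b f).eval t = eval (t • a + b) f := by
  rw [res, polynomial_eval_aeval]
  congr 2
  funext i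
  simp only [Polynomial.eval_add, Polynomial.eval_mul, Polynomial.eval_C, Polynomial.eval_X,
    Pi.add_apply, Pi.smul_apply, smul_eq_mul]
  ring

/-- If every form of small degree satisfying `P m` is divisible by a fixed form `D`, the quotient
satisfying `P (m - e)`, then the degrees of the restrictions of the forms satisfying `P m` are
bounded below. -/
theorem le_natDegree_res_of_division {a b : Fin 3 → K} {D : MvPolynomial (Fin 3) K} {δ : ℕ}
    (hD : D.IsHomogeneous δ) (ha : eval a D ≠ 0) {P : ℕ → MvPolynomial (Fin 3) K → Prop}
    {e A B T : ℕ} (he : 0 < e) (hBA : B ≤ A) (hT : T * e ≤ A * δ)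
    (hstep : ∀ m d f, 0 < m → f.IsHomogeneous d → P m f →
      T * m ≤ B * d ∨ ∃ g, f = D * g ∧ P (m - e) g)
    (m d : ℕ) (f : MvPolynomial (Fin 3) K) (hf : f.IsHomogeneous d) (hP : P m f)
    (h0 : res a b f ≠ 0) :
    T * m ≤ A * (res a b f).natDegree + B * (d - (res a b f).natDegree) := by
  induction m using Nat.strong_induction_on generalizing d f with
  | _ m ih =>
    rcases Nat.eq_zero_or_pos m with rfl | hm
    · simp
    have hle := natDegree_res_le a b hf
    -- If no division is possible, `B ≤ A` turns the bound on `d` into the claim. Otherwise, since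
    -- `D` does not vanish at `a`, division lowers the restricted degree by exactly `δ` and
    -- preserves the defect from `d`, while `T * e ≤ A * δ` pays for the lost multiplicity.
    rcases hstep m d f hm hf hP with h | ⟨g, rfl, hg⟩
    · refine h.trans ?_
      obtain ⟨k, rfl⟩ := Nat.exists_eq_add_of_le hle
      rw [Nat.add_sub_cancel_left, mul_add]
      gcongr
    · have hg0 : g ≠ 0 := by rintro rfl; simp at h0
      have hD0 : D ≠ 0 := by rintro rfl; simp at ha
      obtain ⟨k, rfl, hk⟩ := isHomogeneous_of_mul hD hD0 hg0 hf
      rw [map_mul] at h0 ⊢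
      have h1 := ih (m - e) (by omega) k g hk hg (right_ne_zero_of_mul h0)
      have hgk := natDegree_res_le a b hk
      rw [Polynomial.natDegree_mul (left_ne_zero_of_mul h0) (right_ne_zero_of_mul h0),
        natDegree_res hD ha, Nat.add_sub_add_left, mul_add]
      have h2 : T * m ≤ T * e + T * (m - e) := by
        rw [← mul_add]; gcongr; omega
      omega

/-- The conic is smooth at `p`: along the line towards `q` it has a simple zero there, with nonzero
coefficient `c * polar M p q`. -/
theorem not_hasMult_two_quadForm [Infinite K] {M : Fin 3 → Fin 3 → K}
    {p q : Fin 3 → K} (hp : eval p (quadForm M) = 0)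
    (hq : eval q (quadForm M) = 0) (hpq : polar M p q ≠ 0) {c : K} (hc : c ≠ 0) :
    ¬ HasMult 2 (c • p) (quadForm M) := by
  intro h
  let Γ : Fin 3 → Polynomial K := fun l =>
    Polynomial.C (q l) * Polynomial.X + Polynomial.C (c * p l)
  have h1 : (Polynomial.X - Polynomial.C 0) ^ 2 ∣ aeval Γ (quadForm M) := by
    refine HasMult.dvd_aeval ?_
    convert h using 1
    funext l
    simp [Γ]
  have h2 : aeval Γ (quadForm M) = Polynomial.C (c * polar M p q) * Polynomial.X := by
    refine Polynomial.funext fun t => ?_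
    have : (fun l => (Γ l).eval t) = c • p + t • q := by
      funext l; simp [Γ]; ring
    rw [polynomial_eval_aeval, this, eval_quadForm_add, hp, hq]
    simp
    ring
  rw [h2, Polynomial.C_0, sub_zero, Polynomial.X_pow_dvd_iff] at h1
  have h3 := h1 1 (by norm_num)
  rw [Polynomial.coeff_C_mul, Polynomial.coeff_X_one, mul_one] at h3
  exact mul_ne_zero hc hpq h3

/-- The product of the sides of the polygon with vertices `v`. -/
noncomputable def polygonForm {r : ℕ} [NeZero r] (v : Fin r → Fin 3 → K) : MvPolynomial (Fin 3) K :=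
  ∏ i, lineForm (v i) (v (i + 1))

theorem isHomogeneous_polygonForm {r : ℕ} [NeZero r] (v : Fin r → Fin 3 → K) :
    (polygonForm v).IsHomogeneous r := by
  have := IsHomogeneous.prod Finset.univ (fun i : Fin r => lineForm (v i) (v (i + 1))) (fun _ => 1)
    fun i _ => isHomogeneous_lineForm _ _
  simpa [polygonForm] using this

theorem fin_ne_add_one {r : ℕ} [NeZero r] (hr : 1 < r) (i : Fin r) : i ≠ i + 1 := by
  intro h
  have h1 : (1 : Fin r) = 0 := by simpa using h.symm
  have h2 := congrArg Fin.val h1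
  rw [Fin.val_one', Fin.val_zero, Nat.mod_eq_of_lt hr] at h2
  exact one_ne_zero h2

theorem polygonForm_dvd_of_fatVanishing [Infinite K] {M : Fin 3 → Fin 3 → K}
    (hirr : Irreducible (quadForm M)) (hhom : (quadForm M).IsHomogeneous 2)
    {v : Fin 3 → Fin 3 → K} (hv : PairwiseIndep v) (hC : ∀ i, eval (v i) (quadForm M) = 0)
    {m d : ℕ} {f : MvPolynomial (Fin 3) K} (hd : f.IsHomogeneous d) (hf : FatVanishing v m f)
    (hlt : d < 2 * m) : ∃ g, f = polygonForm v * g ∧ FatVanishing v (m - 2) g := by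
  have hdvd : ∀ {i j : Fin 3}, i ≠ j → lineForm (v i) (v j) ∣ f := fun h =>
    lineForm_dvd_of_fatVanishing hv h hd hf hlt
  have hnd : ∀ i j k l : Fin 3, i ≠ j → i ≠ l → j ≠ l → k ≠ l →
      ¬ lineForm (v k) (v l) ∣ lineForm (v i) (v j) := by
    rintro i j k l hij hil hjl hkl ⟨g, hg⟩
    have := congrArg (eval (v l)) hg
    rw [map_mul, eval_lineForm, eval_lineForm, det3_self_right, zero_mul] at this
    exact not_collinear hirr hhom hv hC hij hil hjl this
  obtain ⟨g₁, rfl⟩ := hdvd (i := 0) (j := 1) (by decide)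
  obtain ⟨w₀, hw₀⟩ := hv 0 1 (by decide)
  obtain ⟨w₁, hw₁⟩ := hv 1 2 (by decide)
  obtain ⟨w₂, hw₂⟩ := hv 2 0 (by decide)
  obtain ⟨g₂, rfl⟩ := ((prime_lineForm hw₁).dvd_or_dvd (hdvd (i := 1) (j := 2)
    (by decide))).resolve_left (hnd 0 1 1 2 (by decide) (by decide) (by decide) (by decide))
  obtain ⟨g, rfl⟩ : lineForm (v 2) (v 0) ∣ g₂ := by
    have h1 := hdvd (i := 2) (j := 0) (by decide)
    have h2 := ((prime_lineForm hw₂).dvd_or_dvd h1).resolve_left fun ⟨g, hg⟩ => by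
      have := congrArg (eval (v 2)) hg
      rw [map_mul, eval_lineForm, eval_lineForm, det3_self_left, zero_mul] at this
      exact not_collinear hirr hhom hv hC (by decide) (by decide) (by decide) this
    exact ((prime_lineForm hw₂).dvd_or_dvd h2).resolve_left
      (hnd 1 2 2 0 (by decide) (by decide) (by decide) (by decide))
  -- Each vertex lies on exactly two of the three sides, so dividing by the triangle costs two
  -- orders and no more.
  refine ⟨g, ?_, fun i c hc => ?_⟩
  · rw [polygonForm, Fin.prod_univ_three]
    simp only [zero_add, Fin.reduceAdd]
    ring
  have hne : ∀ {i j k : Fin 3}, i ≠ j → i ≠ k → j ≠ k →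
      eval (c • v k) (lineForm (v i) (v j)) ≠ 0 := by
    intro i j k hij hik hjk
    rw [eval_lineForm, det3_smul_right]
    exact mul_ne_zero hc (not_collinear hirr hhom hv hC hij hik hjk)
  have h := hf i c hc
  rw [show m - 2 = m - 1 - 1 by omega]
  fin_cases i
  · exact (HasMult.of_mul_of_eval_ne_zero (hne (by decide) (by decide) (by decide))
      (h.of_lineForm_mul hw₀)).of_lineForm_mul hw₂
  · refine HasMult.of_mul_of_eval_ne_zero (hne (i := 2) (j := 0) ?_ ?_ ?_)
      ((h.of_lineForm_mul hw₀).of_lineForm_mul hw₁) <;> decide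
  · exact ((HasMult.of_mul_of_eval_ne_zero (hne (by decide) (by decide) (by decide))
      h).of_lineForm_mul hw₁).of_lineForm_mul hw₂

/-- The restrictions of forms vanishing to order `m` at points of a conic have large degree. -/
theorem le_natDegree_res [Infinite K] {M : Fin 3 → Fin 3 → K}
    (hirr : Irreducible (quadForm M)) (hhom : (quadForm M).IsHomogeneous 2) {r : ℕ} [NeZero r]
    (hr : 1 < r) {v : Fin r → Fin 3 → K} (hv : PairwiseIndep v)
    (hC : ∀ i, eval (v i) (quadForm M) = 0) {a b : Fin 3 → K} (haC : eval a (quadForm M) ≠ 0)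
    (haL : ∀ i, det3 (v i) (v (i + 1)) a ≠ 0) {m d : ℕ} {f : MvPolynomial (Fin 3) K}
    (hf : f.IsHomogeneous d) (hfm : FatVanishing v m f) (h0 : res a b f ≠ 0) :
    min r 4 * max r 4 * m ≤ 2 * max r 4 * (res a b f).natDegree +
      2 * min r 4 * (d - (res a b f).natDegree) := by
  have : Nontrivial (Fin r) := Fin.nontrivial_iff_two_le.2 hr
  -- The dividing curves have degree and cost in multiplicity `(δ, e) = (2, 1)` for the conic, `(1,
  -- 1)` for the line and `(3, 2)` for the triangle. In each case `T * e = A * δ`, so the bound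
  -- loses nothing.
  by_cases h4 : 4 ≤ r
  · rw [min_eq_right h4, max_eq_left h4]
    refine le_natDegree_res_of_division hhom haC (P := FatVanishing v) (e := 1) one_pos (by omega)
      (by omega) (fun m d f hm hd hf => ?_) m d f hf hfm h0
    by_cases hlt : 2 * d < r * m
    · right
      obtain ⟨g, rfl⟩ := quadForm_dvd_of_fatVanishing hirr hhom hv hC hd hf (by simpa using hlt)
      refine ⟨g, rfl, fun i c hc => (hf i c hc).of_mul ?_⟩
      obtain ⟨j, hj⟩ := exists_ne i
      obtain ⟨w, hw⟩ := hv i j hj.symm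
      exact not_hasMult_two_quadForm (hC i) (hC j)
        (polar_ne_zero hirr hhom hw (hC i) (hC j)) hc
    · left
      rw [mul_assoc]
      omega
  · obtain rfl | rfl : r = 2 ∨ r = 3 := by omega
    · refine le_natDegree_res_of_division (isHomogeneous_lineForm (v 0) (v (0 + 1)))
        (by simpa using haL 0) (P := FatVanishing v) (e := 1) one_pos (by decide)
        (by decide) (fun m d f hm hd hf => ?_) m d f hf hfm h0
      by_cases hlt : d < 2 * m
      · right
        obtain ⟨w, hw⟩ := hv 0 (0 + 1) (fin_ne_add_one hr 0)
        obtain ⟨g, rfl⟩ := lineForm_dvd_of_fatVanishing hv (fin_ne_add_one hr 0) hd hf hlt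
        exact ⟨g, rfl, fun i c hc => (hf i c hc).of_lineForm_mul hw⟩
      · left
        norm_num
        omega
    · refine le_natDegree_res_of_division (isHomogeneous_polygonForm v)
        ?_ (P := FatVanishing v) (e := 2) two_pos (by decide)
        (by decide) (fun m d f hm hd hf => ?_) m d f hf hfm h0
      · rw [polygonForm, map_prod]
        exact Finset.prod_ne_zero_iff.2 fun i _ => by simpa using haL i
      by_cases hlt : d < 2 * m
      · exact Or.inr (polygonForm_dvd_of_fatVanishing hirr hhom hv hC hd hf hlt)
      · left
        norm_num
        omega

/-! ### Forms with prescribed restriction: the upper bound -/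

theorem exists_bezout_natDegree_le {A B q : Polynomial K} (hAB : IsCoprime A B)
    (hA : A.natDegree ≠ 0) {N : ℕ} (hq : q.natDegree ≤ N) (hN : A.natDegree + B.natDegree ≤ N) :
    ∃ s t : Polynomial K, q = s * A + t * B ∧ s.natDegree ≤ N - A.natDegree ∧
      t.natDegree ≤ N - B.natDegree := by
  obtain ⟨s, t, hst⟩ := hAB
  -- Reducing the cofactor of `B` modulo `A` bounds its degree, and the degree of the other cofactor
  -- is then forced by the identity.
  have ht := Polynomial.natDegree_mod_lt (q * t) hA
  have hdm := EuclideanDomain.div_add_mod (q * t) A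
  have heq : q = (q * s + B * (q * t / A)) * A + (q * t % A) * B := by
    linear_combination (-B) * hdm - q * hst
  refine ⟨_, _, heq, ?_, by omega⟩
  set u := q * s + B * (q * t / A)
  rcases eq_or_ne u 0 with h0 | h0
  · simp [h0]
  have hA0 : A ≠ 0 := by rintro rfl; simp at hA
  have h1 : u * A = q - (q * t % A) * B := by linear_combination -heq
  have h2 : (u * A).natDegree ≤ N := by
    rw [h1]
    refine Polynomial.natDegree_sub_le_of_le hq ?_ |>.trans (max_self N).le
    exact Polynomial.natDegree_mul_le.trans (by omega)
  rw [Polynomial.natDegree_mul h0 hA0] at h2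
  omega

/-- The linear forms `lineForm b w` and `lineForm w a` restrict to `X` and `1`, so `q` is lifted by
homogenizing it in them. -/
theorem exists_res_eq {a b w : Fin 3 → K} (hw : det3 a b w = 1) {N : ℕ} {q : Polynomial K}
    (hq : q.natDegree ≤ N) : ∃ f : MvPolynomial (Fin 3) K, f.IsHomogeneous N ∧ res a b f = q := by
  have hlin : ∀ p p' : Fin 3 → K, res a b (lineForm p p') =
      Polynomial.C (det3 p p' a) * Polynomial.X + Polynomial.C (det3 p p' b) := by
    intro p p'
    simp only [res, lineForm, det3, map_add, map_mul, aeval_X, algHom_C, Polynomial.algebraMap_eq]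
    ring
  have hx : res a b (lineForm b w) = Polynomial.X := by
    have h1 : det3 b w a = 1 := by rw [← hw]; simp only [det3]; ring
    rw [hlin, h1, det3_self_left]; simp
  have hy : res a b (lineForm w a) = 1 := by
    have h1 : det3 w a b = 1 := by rw [← hw]; simp only [det3]; ring
    rw [hlin, h1, det3_self_right]; simp
  refine ⟨∑ k ∈ Finset.range (N + 1), C (q.coeff k) * (lineForm b w ^ k * lineForm w a ^ (N - k)),
    IsHomogeneous.sum _ _ _ fun k hk => ?_, ?_⟩
  · have h1 : k ≤ N := Nat.lt_succ_iff.1 (Finset.mem_range.1 hk)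
    refine IsHomogeneous.C_mul ?_ _
    have := ((isHomogeneous_lineForm b w).pow k).mul ((isHomogeneous_lineForm w a).pow (N - k))
    rwa [one_mul, one_mul, Nat.add_sub_cancel' h1] at this
  · conv_rhs => rw [Polynomial.as_sum_range_C_mul_X_pow' q (Nat.lt_succ_of_le hq)]
    rw [map_sum]
    refine Finset.sum_congr rfl fun k _ => ?_
    rw [map_mul, map_mul, map_pow, map_pow, hx, hy, one_pow, mul_one, algHom_C,
      Polynomial.algebraMap_eq]

/-- If two forms of degrees `α ≤ β` in the second symbolic power restrict to coprime polynomials,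
then the restriction of forms of degree at least `β * k + α` in the `2 * k`-th symbolic power is
onto. -/
theorem exists_mem_symbolicPower_res_eq {ι : Type*} [Finite ι] {v : ι → Fin 3 → K}
    (hv : PairwiseIndep v) {a b w : Fin 3 → K} (hw : det3 a b w = 1)
    {A B : MvPolynomial (Fin 3) K} {α β : ℕ} (hα : 0 < α) (hαβ : α ≤ β)
    (hA : A ∈ symbolicPower (coneIdeal v) 2) (hB : B ∈ symbolicPower (coneIdeal v) 2)
    (hAα : A.IsHomogeneous α) (hBβ : B.IsHomogeneous β) (hAa : eval a A ≠ 0) (hBa : eval a B ≠ 0)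
    (hAB : IsCoprime (res a b A) (res a b B)) (k N : ℕ) (hN : β * k + α ≤ N) (q : Polynomial K)
    (hq : q.natDegree ≤ N) :
    ∃ f ∈ symbolicPower (coneIdeal v) (2 * k), f.IsHomogeneous N ∧ res a b f = q := by
  induction k generalizing N q with
  | zero =>
    obtain ⟨f, hf, hfq⟩ := exists_res_eq hw hq
    exact ⟨f, mem_symbolicPower_zero hv f, hf, hfq⟩
  | succ k ih =>
    rw [mul_add, mul_one] at hN
    have hA' := natDegree_res (b := b) hAα hAa
    have hB' := natDegree_res (b := b) hBβ hBa
    -- Both cofactors are lifted by induction. The summand `α` in the bound ensures `α + β ≤ N`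
    -- here, and `α ≤ β` ensures that `N - α` and `N - β` are still large enough.
    obtain ⟨s, t, rfl, hs, ht⟩ := exists_bezout_natDegree_le hAB (by omega) hq
      (by rw [hA', hB']; omega)
    rw [hA'] at hs
    rw [hB'] at ht
    obtain ⟨f, hf, hfN, rfl⟩ := ih (N - α) (by omega) s hs
    obtain ⟨g, hg, hgN, rfl⟩ := ih (N - β) (by omega) t ht
    refine ⟨f * A + g * B, Ideal.add_mem _ (mul_mem_symbolicPower hv hf hA)
      (mul_mem_symbolicPower hv hg hB), IsHomogeneous.add ?_ ?_, by simp⟩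
    · have := hfN.mul hAα
      rwa [Nat.sub_add_cancel (by omega)] at this
    · have := hgN.mul hBβ
      rwa [Nat.sub_add_cancel (by omega)] at this

/-- The vertex `v i` lies on the sides with indices `i` and `i - 1`, which are distinct factors. For
`r = 2` the polygon is the line counted twice. -/
theorem polygonForm_mem_symbolicPower {r : ℕ} [NeZero r] (hr : 1 < r) {v : Fin r → Fin 3 → K}
    (hv : PairwiseIndep v) : polygonForm v ∈ symbolicPower (coneIdeal v) 2 := by
  refine mem_symbolicPower_two hv fun i => ?_
  have hne : i - 1 ≠ i := by
    have := fin_ne_add_one hr (i - 1)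
    rwa [sub_add_cancel] at this
  refine ⟨lineForm (v i) (v (i + 1)), lineForm (v (i - 1)) (v (i - 1 + 1)),
    ∏ j ∈ (Finset.univ.erase i).erase (i - 1), lineForm (v j) (v (j + 1)),
    mem_lineIdeal_of_isHomogeneous (isHomogeneous_lineForm _ _) (by simp),
    mem_lineIdeal_of_isHomogeneous (isHomogeneous_lineForm _ _) (by simp), ?_⟩
  rw [mul_assoc, Finset.mul_prod_erase _ (fun j => lineForm (v j) (v (j + 1))) (by simp [hne]),
    Finset.mul_prod_erase _ (fun j => lineForm (v j) (v (j + 1))) (by simp), polygonForm]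

/-! ### General position and the degrees occurring on a general line -/

/-- The data of an irreducible conic through a family of at least two distinct points. -/
structure ConicThrough {r : ℕ} (M : Fin 3 → Fin 3 → K) (v : Fin r → Fin 3 → K) : Prop where
  one_lt : 1 < r
  irreducible : Irreducible (quadForm M)
  isHomogeneous : (quadForm M).IsHomogeneous 2
  pairwiseIndep : PairwiseIndep v
  eval_eq_zero : ∀ i, eval (v i) (quadForm M) = 0

/-- General position of the line through `a` and `b`, and of the point `a`, with respect to a conic
and a family of points. -/
structure GeneralPosition {r : ℕ} [NeZero r] (M : Fin 3 → Fin 3 → K) (v : Fin r → Fin 3 → K)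
    (a b : Fin 3 → K) : Prop where
  eval_ne_zero : eval a (quadForm M) ≠ 0
  side_ne_zero : ∀ i, det3 (v i) (v (i + 1)) a ≠ 0
  det_ne_zero : ∀ i, det3 a b (v i) ≠ 0

section

variable {r : ℕ} [NeZero r] {M : Fin 3 → Fin 3 → K} {v : Fin r → Fin 3 → K} {a b : Fin 3 → K}

theorem GeneralPosition.exists_det3_eq_one (h : GeneralPosition M v a b) :
    ∃ w, det3 a b w = 1 :=
  ⟨(det3 a b (v 0))⁻¹ • v 0, by rw [det3_smul_right, inv_mul_cancel₀ (h.det_ne_zero 0)]⟩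

/-- A side meets the conic only in its two vertices, and the general line passes through no vertex;
hence the conic and the polygon have no common zero on that line. -/
theorem GeneralPosition.isCoprime [Infinite K] (hC : ConicThrough M v)
    (h : GeneralPosition M v a b) :
    IsCoprime (res a b (quadForm M ^ 2)) (res a b (polygonForm v)) := by
  rw [map_pow, polygonForm, map_prod]
  refine IsCoprime.pow_left (IsCoprime.prod_right fun i _ => ?_)
  have hw := hC.pairwiseIndep i (i + 1) (fin_ne_add_one hC.one_lt i)
  obtain ⟨w, hw⟩ := hw
  have hs := h.side_ne_zero i
  set c := det3 (v i) (v (i + 1)) a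
  set t := -det3 (v i) (v (i + 1)) b / c with ht
  have h1 : res a b (lineForm (v i) (v (i + 1))) =
      Polynomial.C c * (Polynomial.X - Polynomial.C t) := by
    refine Polynomial.funext fun x => ?_
    rw [eval_res, eval_lineForm, det3_add, det3_smul_right]
    simp only [Polynomial.eval_mul, Polynomial.eval_sub, Polynomial.eval_C, Polynomial.eval_X]
    rw [mul_sub, ht, mul_div_cancel₀ _ hs]
    ring
  have h2 : eval (t • a + b) (quadForm M) ≠ 0 := by
    intro h0
    have h3 : det3 (v i) (v (i + 1)) (t • a + b) = 0 := by
      rw [det3_add, det3_smul_right, ht, div_mul_cancel₀ _ hs]; ring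
    obtain ⟨x, y, hxy⟩ := exists_eq_add_of_det3_eq_zero hw h3
    rw [hxy, eval_quadForm_add, hC.eval_eq_zero, hC.eval_eq_zero] at h0
    have hpol := polar_ne_zero hC.irreducible hC.isHomogeneous hw (hC.eval_eq_zero i)
      (hC.eval_eq_zero (i + 1))
    simp only [mul_zero, add_zero, zero_add, mul_eq_zero, hpol, or_false] at h0
    have hline : x * det3 a b (v i) + y * det3 a b (v (i + 1)) = 0 := by
      rw [← det3_smul_right, ← det3_smul_right, ← det3_add, ← hxy, det3_add, det3_smul_right,
        det3_self_left, det3_self_right]; ring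
    have hxy0 : x = 0 ∧ y = 0 := by
      rcases h0 with rfl | rfl
      · simpa [h.det_ne_zero] using hline
      · simpa [h.det_ne_zero] using hline
    rw [hxy0.1, hxy0.2, zero_smul, zero_smul, add_zero] at hxy
    refine h.det_ne_zero 0 ?_
    have hb : b = (-t) • a := by rw [neg_smul]; exact eq_neg_of_add_eq_zero_right hxy
    rw [hb]
    simp only [det3, Pi.smul_apply, smul_eq_mul]; ring
  rw [h1]
  refine IsCoprime.symm ((isCoprime_mul_unit_left_left (Polynomial.isUnit_C.2
    (isUnit_iff_ne_zero.2 hs)) _ _).2 ?_)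
  refine (Polynomial.irreducible_X_sub_C t).coprime_iff_not_dvd.2 fun hd => h2 ?_
  rw [← eval_res]
  exact Polynomial.dvd_iff_isRoot.1 hd

theorem GeneralPosition.exists_pair [Infinite K] (hC : ConicThrough M v)
    (h : GeneralPosition M v a b) :
    ∃ A ∈ symbolicPower (coneIdeal v) 2, ∃ B ∈ symbolicPower (coneIdeal v) 2,
      A.IsHomogeneous (min r 4) ∧ B.IsHomogeneous (max r 4) ∧ eval a A ≠ 0 ∧ eval a B ≠ 0 ∧
        IsCoprime (res a b A) (res a b B) := by
  have h1 := polygonForm_mem_symbolicPower hC.one_lt hC.pairwiseIndep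
  have h2 : quadForm M ^ 2 ∈ symbolicPower (coneIdeal v) 2 :=
    mem_symbolicPower_of_mem_pow hC.pairwiseIndep (Ideal.pow_mem_pow (mem_coneIdeal.2 fun i =>
      mem_lineIdeal_of_isHomogeneous hC.isHomogeneous (hC.eval_eq_zero i)) 2)
  have h3 := isHomogeneous_polygonForm v
  have h4 : (quadForm M ^ 2).IsHomogeneous 4 := hC.isHomogeneous.pow 2
  have h5 : eval a (polygonForm v) ≠ 0 := by
    rw [polygonForm, map_prod]
    exact Finset.prod_ne_zero_iff.2 fun i _ => by simpa using h.side_ne_zero i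
  have h6 : eval a (quadForm M ^ 2) ≠ 0 := by
    rw [map_pow]; exact pow_ne_zero 2 h.eval_ne_zero
  have h7 := h.isCoprime hC
  rcases le_total r 4 with hr | hr
  · rw [min_eq_left hr, max_eq_right hr]
    exact ⟨_, h1, _, h2, h3, h4, h5, h6, h7.symm⟩
  · rw [min_eq_right hr, max_eq_left hr]
    exact ⟨_, h2, _, h1, h4, h3, h6, h5, h7⟩

/-- The degrees of the restrictions to the line `t ↦ t • a + b` of the forms of degree `N` in
`J`. -/
def degSet (J : Ideal (MvPolynomial (Fin 3) K)) (a b : Fin 3 → K) (N : ℕ) : Set ℕ :=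
  {n | ∃ f ∈ J, f.IsHomogeneous N ∧ res a b f ≠ 0 ∧ (res a b f).natDegree = n}

theorem le_of_mem_degSet {J : Ideal (MvPolynomial (Fin 3) K)} {a b : Fin 3 → K} {N n : ℕ}
    (hn : n ∈ degSet J a b N) : n ≤ N := by
  obtain ⟨f, -, hf, -, rfl⟩ := hn
  exact natDegree_res_le a b hf

/-- From this bound on, every degree occurs. The exponent `(m + 1) / 2` is `m / 2` rounded up,
because the two forms used lie in the second symbolic power. -/
theorem GeneralPosition.mem_degSet [Infinite K] (hC : ConicThrough M v)
    (h : GeneralPosition M v a b) {m N n : ℕ}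
    (hN : max r 4 * ((m + 1) / 2) + min r 4 ≤ N) (hn : n ≤ N) :
    n ∈ degSet (symbolicPower (coneIdeal v) m) a b N := by
  obtain ⟨A, hA, B, hB, hA1, hB1, hA2, hB2, hAB⟩ := h.exists_pair hC
  obtain ⟨w, hw⟩ := h.exists_det3_eq_one
  have hr := hC.one_lt
  obtain ⟨f, hf, hfN, hfq⟩ := exists_mem_symbolicPower_res_eq hC.pairwiseIndep hw
    (by rw [lt_min_iff]; omega) min_le_max hA hB hA1 hB1 hA2 hB2 hAB ((m + 1) / 2) N hN
    (Polynomial.X ^ n) (by simpa using hn)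
  refine ⟨f, symbolicPower_antitone hC.pairwiseIndep (by omega) hf, hfN, ?_, ?_⟩
  · rw [hfq]; exact pow_ne_zero _ Polynomial.X_ne_zero
  · rw [hfq, Polynomial.natDegree_X_pow]

theorem GeneralPosition.mul_mem_degSet [Infinite K] (hC : ConicThrough M v)
    (h : GeneralPosition M v a b) (m : ℕ) :
    min r 4 * ((m + 1) / 2) ∈
      degSet (symbolicPower (coneIdeal v) m) a b (min r 4 * ((m + 1) / 2)) := by
  obtain ⟨A, hA, -, -, hA1, -, hA2, -, -⟩ := h.exists_pair hC
  have hd := hA1.pow ((m + 1) / 2)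
  have hpow : ∀ k, A ^ k ∈ symbolicPower (coneIdeal v) (2 * k) := by
    intro k
    induction k with
    | zero => exact mem_symbolicPower_zero hC.pairwiseIndep _
    | succ k ih =>
      rw [pow_succ, mul_add, mul_one]
      exact mul_mem_symbolicPower hC.pairwiseIndep ih hA
  have hne : eval a (A ^ ((m + 1) / 2)) ≠ 0 := by rw [map_pow]; exact pow_ne_zero _ hA2
  refine ⟨A ^ ((m + 1) / 2), symbolicPower_antitone hC.pairwiseIndep (by omega) (hpow _), hd, ?_,
    natDegree_res hd hne⟩
  intro h0
  rw [← coeff_res a b hd, h0, Polynomial.coeff_zero] at hne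
  exact hne rfl

theorem GeneralPosition.le_of_mem_degSet [Infinite K] (hC : ConicThrough M v)
    (h : GeneralPosition M v a b) {m N n : ℕ}
    (hn : n ∈ degSet (symbolicPower (coneIdeal v) m) a b N) :
    min r 4 * max r 4 * m ≤ 2 * max r 4 * n + 2 * min r 4 * (N - n) := by
  obtain ⟨f, hf, hfN, h0, rfl⟩ := hn
  exact le_natDegree_res hC.irreducible hC.isHomogeneous hC.one_lt hC.pairwiseIndep
    hC.eval_eq_zero h.eval_ne_zero h.side_ne_zero hfN
    (fatVanishing_of_mem_symbolicPower hC.pairwiseIndep hfN hf) h0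

end

/-! ### Initial monomials -/

/-- The exponent vector of `x ^ i * y ^ j`. -/
noncomputable def expXY (i j : ℕ) : Fin 3 →₀ ℕ := Finsupp.single 0 i + Finsupp.single 1 j

@[simp] theorem expXY_zero (i j : ℕ) : expXY i j 0 = i := by simp [expXY]
@[simp] theorem expXY_one (i j : ℕ) : expXY i j 1 = j := by simp [expXY]
@[simp] theorem expXY_two (i j : ℕ) : expXY i j 2 = 0 := by simp [expXY]

theorem degree_fin_three (e : Fin 3 →₀ ℕ) : e.degree = e 0 + e 1 + e 2 := by
  rw [Finsupp.degree_eq_sum, Fin.sum_univ_three]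

theorem eq_expXY {e : Fin 3 →₀ ℕ} (h : e 2 = 0) : e = expXY (e 0) (e 1) := by
  ext i
  fin_cases i <;> simp [h]

theorem single_add_expXY (e : Fin 3 →₀ ℕ) : Finsupp.single 2 (e 2) + expXY (e 0) (e 1) = e := by
  ext i
  fin_cases i <;> simp

theorem monomial_expXY (i j : ℕ) :
    monomial (expXY i j) 1 = (X 0 ^ i * X 1 ^ j : MvPolynomial (Fin 3) K) := by
  rw [X_pow_eq_monomial, X_pow_eq_monomial, monomial_mul, one_mul, expXY]

/-- The substitution `x ↦ X`, `y ↦ 1`, `z ↦ 0`. -/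
noncomputable def evalLine : MvPolynomial (Fin 3) K →ₐ[K] Polynomial K :=
  aeval ![Polynomial.X, 1, 0]

theorem coeff_evalLine {q : MvPolynomial (Fin 3) K} {N k : ℕ} (hq : q.IsHomogeneous N)
    (hk : k ≤ N) : (evalLine q).coeff k = coeff (expXY k (N - k)) q := by
  classical
  rw [evalLine, aeval_def, eval₂_eq', Polynomial.finsetSum_coeff,
    Finset.sum_eq_single (expXY k (N - k))]
  · simp [Fin.prod_univ_three, Polynomial.algebraMap_eq]
  · intro e he hne
    have hd := hq.degree_eq_sum_deg_support he
    have hd' : e.degree = N := hd.symm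
    rw [degree_fin_three] at hd'
    rw [Fin.prod_univ_three, Polynomial.algebraMap_eq, Polynomial.coeff_C_mul]
    by_cases h2 : e 2 = 0
    · simp only [Matrix.cons_val_zero, Matrix.cons_val_one, Matrix.cons_val, one_pow, mul_one, h2,
        pow_zero, Polynomial.coeff_X_pow]
      rw [if_neg, mul_zero]
      rintro rfl
      refine hne ((eq_expXY h2).trans ?_)
      congr 1
      omega
    · simp [h2]
  · intro h
    rw [notMem_support_iff.1 h]
    simp

theorem natDegree_evalLine_le {q : MvPolynomial (Fin 3) K} {N : ℕ} (hq : q.IsHomogeneous N) :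
    (evalLine q).natDegree ≤ N := by
  have := natDegree_aeval_le (Γ := ![(Polynomial.X : Polynomial K), 1, 0]) (k := 1) (fun i => by
    fin_cases i <;> simp) hq
  simpa [evalLine] using this

/-- Among monomials of equal degree, those containing `z` come last, and those without `z` are
ordered by their exponent of `x`; so the leading term on `z = 0` is the initial term. -/
theorem isInitialExponent_of_evalLine {q : MvPolynomial (Fin 3) K} {N : ℕ}
    (hq : q.IsHomogeneous N) (h0 : evalLine q ≠ 0) :
    IsInitialExponent q (expXY (evalLine q).natDegree (N - (evalLine q).natDegree)) := by
  have hle := natDegree_evalLine_le hq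
  refine ⟨?_, fun e he hne => Or.inr ?_⟩
  · rw [mem_support_iff, ← coeff_evalLine hq hle]
    exact Polynomial.leadingCoeff_ne_zero.2 h0
  · have hd : e.degree = N := (hq.degree_eq_sum_deg_support he).symm
    rw [hd, degree_fin_three]
    rw [degree_fin_three] at hd
    refine ⟨by simp; omega, ?_⟩
    by_cases h2 : e 2 = 0
    · have h3 : e 0 ≤ (evalLine q).natDegree := by
        refine Polynomial.le_natDegree_of_ne_zero ?_
        rw [coeff_evalLine hq (by omega), show N - e 0 = e 1 by omega, ← eq_expXY h2]
        exact mem_support_iff.1 he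
      have h4 : e 0 ≠ (evalLine q).natDegree := by
        intro h
        refine hne ((eq_expXY h2).trans ?_)
        rw [← h]
        congr 1
        omega
      refine ⟨1, by simp; omega, fun j hj => ?_⟩
      obtain rfl : j = 2 := by omega
      simp [h2]
    · exact ⟨2, by simp; omega, fun j hj => by omega⟩

theorem le_of_revLexLT {e f : Fin 3 →₀ ℕ} (hd : f.degree = e.degree) (h : RevLexLT f e) :
    e 2 ≤ f 2 ∧ (f 2 = e 2 → f 0 < e 0) := by
  rcases h with h | ⟨-, i, hi, hj⟩
  · omega
  rw [degree_fin_three, degree_fin_three] at hd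
  fin_cases i
  · have h1 := hj 1 (by decide)
    have h2 := hj 2 (by decide)
    simp at hi
    omega
  · have h2 := hj 2 (by decide)
    simp at hi
    omega
  · simp at hi
    omega

theorem evalLine_of_isInitialExponent {q : MvPolynomial (Fin 3) K} {N : ℕ}
    (hq : q.IsHomogeneous N) {e : Fin 3 →₀ ℕ} (he : IsInitialExponent q e) (h2 : e 2 = 0) :
    evalLine q ≠ 0 ∧ (evalLine q).natDegree = e 0 ∧ N = e 0 + e 1 := by
  have hd : e.degree = N := (hq.degree_eq_sum_deg_support he.1).symm
  have hd' := hd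
  rw [degree_fin_three] at hd'
  have h1 : (evalLine q).coeff (e 0) ≠ 0 := by
    rw [coeff_evalLine hq (by omega), show N - e 0 = e 1 by omega, ← eq_expXY h2]
    exact mem_support_iff.1 he.1
  refine ⟨fun h => h1 (by rw [h, Polynomial.coeff_zero]), ?_, by omega⟩
  refine le_antisymm (Polynomial.natDegree_le_iff_coeff_eq_zero.2 fun k hk => ?_)
    (Polynomial.le_natDegree_of_ne_zero h1)
  by_cases hkN : k ≤ N
  · rw [coeff_evalLine hq hkN]
    by_contra hne
    have hlt := he.2 (expXY k (N - k)) (mem_support_iff.2 hne) (by rintro rfl; simp at hk)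
    have := (le_of_revLexLT (by rw [hd, degree_fin_three]; simp; omega) hlt).2 (by simp [h2])
    simp at this
    omega
  · exact Polynomial.coeff_eq_zero_of_natDegree_lt
      ((natDegree_evalLine_le hq).trans_lt (not_le.1 hkN))

theorem revLexLT_add_left {s e f : Fin 3 →₀ ℕ} : RevLexLT (s + e) (s + f) ↔ RevLexLT e f := by
  simp [RevLexLT, map_add]

/-- A form is divisible by the power of `z` occurring in its initial monomial. -/
theorem exists_eq_X_pow_mul {q : MvPolynomial (Fin 3) K} {N : ℕ} (hq : q.IsHomogeneous N)
    {e : Fin 3 →₀ ℕ} (he : IsInitialExponent q e) :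
    ∃ q', q = X 2 ^ e 2 * q' ∧ IsInitialExponent q' (expXY (e 0) (e 1)) := by
  have hdeg : ∀ f ∈ q.support, f.degree = e.degree := fun f hf =>
    (hq.degree_eq_sum_deg_support hf).symm.trans (hq.degree_eq_sum_deg_support he.1)
  -- The characteristic property of the reverse lexicographic order: no monomial of a form contains
  -- `z` to a lower power than the initial one.
  have hle : ∀ f ∈ q.support, e 2 ≤ f 2 := by
    intro f hf
    by_cases hfe : f = e
    · rw [hfe]
    · exact (le_of_revLexLT (hdeg f hf) (he.2 f hf hfe)).1
  have hdvd : X 2 ^ e 2 ∣ q := by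
    rw [X_pow_eq_monomial, monomial_one_dvd_iff_modMonomial_eq_zero]
    ext f
    by_cases hf : Finsupp.single 2 (e 2) ≤ f
    · rw [coeff_modMonomial_of_le _ hf, coeff_zero]
    · rw [coeff_modMonomial_of_not_le _ hf, coeff_zero]
      by_contra hne
      exact hf (by simpa using hle f (mem_support_iff.2 hne))
  obtain ⟨q', rfl⟩ := hdvd
  refine ⟨q', rfl, ?_⟩
  have hmem : ∀ f, f ∈ q'.support ↔ Finsupp.single 2 (e 2) + f ∈ (X 2 ^ e 2 * q').support := by
    intro f
    rw [mem_support_iff, mem_support_iff, X_pow_eq_monomial, coeff_monomial_mul, one_mul]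
  have hadd := single_add_expXY e
  refine ⟨(hmem _).2 (by rw [hadd]; exact he.1), fun f hf hne => ?_⟩
  have h1 : RevLexLT (Finsupp.single 2 (e 2) + f)
      (Finsupp.single 2 (e 2) + expXY (e 0) (e 1)) := by
    rw [hadd]
    exact he.2 _ ((hmem f).1 hf) fun h => hne (add_left_cancel (h.trans hadd.symm))
  exact revLexLT_add_left.1 h1

/-! ### Linear changes of coordinates -/

theorem eval_coordChange (g : GL (Fin 3) K) (f : MvPolynomial (Fin 3) K) (x : Fin 3 → K) :
    eval x (coordChange g f) = eval (g.1.mulVec x) f := by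
  rw [coordChange, eval_aeval]
  congr 2
  funext i
  simp [Matrix.mulVec, dotProduct]

theorem coordChange_coordChange_inv [Infinite K] (g : GL (Fin 3) K)
    (f : MvPolynomial (Fin 3) K) : coordChange g (coordChange g⁻¹ f) = f := by
  refine MvPolynomial.funext fun x => ?_
  rw [eval_coordChange, eval_coordChange, Matrix.mulVec_mulVec, ← Units.val_mul, inv_mul_cancel,
    Units.val_one, Matrix.one_mulVec]

theorem coordChange_surjective [Infinite K] (g : GL (Fin 3) K) :
    Function.Surjective (coordChange g) :=
  fun f => ⟨coordChange g⁻¹ f, coordChange_coordChange_inv g f⟩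

theorem coordChange_injective [Infinite K] (g : GL (Fin 3) K) :
    Function.Injective (coordChange g) := by
  refine Function.LeftInverse.injective (g := coordChange g⁻¹) fun f => ?_
  have := coordChange_coordChange_inv g⁻¹ f
  rwa [inv_inv] at this

theorem isHomogeneous_coordChange (g : GL (Fin 3) K) {f : MvPolynomial (Fin 3) K} {d : ℕ}
    (hf : f.IsHomogeneous d) : (coordChange g f).IsHomogeneous d := by
  have := hf.aeval (fun i => ∑ j, C (g.1 i j) * X j : Fin 3 → MvPolynomial (Fin 3) K) (n := 1)
    fun i => IsHomogeneous.sum _ _ _ fun j _ => isHomogeneous_C_mul_X _ _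
  rwa [one_mul] at this

theorem homogeneousComponent_coordChange (g : GL (Fin 3) K) (f : MvPolynomial (Fin 3) K) (k : ℕ) :
    homogeneousComponent k (coordChange g f) = coordChange g (homogeneousComponent k f) := by
  conv_lhs => rw [← sum_homogeneousComponent f, map_sum, map_sum]
  have hj : ∀ j, homogeneousComponent k (coordChange g (homogeneousComponent j f)) =
      if k = j then coordChange g (homogeneousComponent k f) else 0 := by
    intro j
    rw [homogeneousComponent_of_mem (isHomogeneous_coordChange g
      (homogeneousComponent_isHomogeneous j f))]
    split_ifs with h <;> simp_all
  simp only [hj, Finset.sum_ite_eq]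
  split_ifs with h
  · rfl
  · rw [homogeneousComponent_eq_zero, map_zero]
    simp at h
    omega

theorem evalLine_coordChange (g : GL (Fin 3) K) (f : MvPolynomial (Fin 3) K) :
    evalLine (coordChange g f) = res (fun i => g.1 i 0) (fun i => g.1 i 1) f := by
  induction f using MvPolynomial.induction_on with
  | C a => simp [evalLine, coordChange, res]
  | add f h hf hh => rw [map_add, map_add, map_add, hf, hh]
  | mul_X f i hf =>
    rw [map_mul, map_mul, map_mul, hf]
    simp [evalLine, coordChange, res, Fin.sum_univ_three, Polynomial.algebraMap_eq]

theorem isInitialExponent_homogeneousComponent {f : MvPolynomial (Fin 3) K} {e : Fin 3 →₀ ℕ}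
    (he : IsInitialExponent f e) :
    IsInitialExponent (homogeneousComponent e.degree f) e := by
  refine ⟨?_, fun b hb hne => he.2 b ?_ hne⟩
  · rw [mem_support_iff, coeff_homogeneousComponent, if_pos rfl]
    exact mem_support_iff.1 he.1
  · rw [mem_support_iff, coeff_homogeneousComponent] at hb
    rw [mem_support_iff]
    exact fun h => hb (by rw [h, ite_self])

/-- The ideal generated by the monomials `x ^ n * y ^ (N - n)` for `n ∈ S N`. -/
noncomputable def degIdeal (K : Type*) [Field K] (S : ℕ → Set ℕ) : Ideal (MvPolynomial (Fin 3) K) :=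
  Ideal.span ((fun e : ℕ × ℕ => (X 0 ^ e.1 * X 1 ^ e.2 : MvPolynomial (Fin 3) K)) ''
    {e | e.1 ∈ S (e.1 + e.2)})

/-- The initial ideal of a homogeneous ideal modulo which `z` is not a zero divisor after a change
of coordinates, in terms of restrictions to the line `z = 0`. -/
theorem initialIdeal_map_coordChange [Infinite K] {J : Ideal (MvPolynomial (Fin 3) K)}
    (hJ : ∀ f ∈ J, ∀ k, homogeneousComponent k f ∈ J) (g : GL (Fin 3) K)
    (hz : ∀ f, coordChange g⁻¹ (X 2) * f ∈ J → f ∈ J) :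
    initialIdeal (J.map (coordChange g)) =
      degIdeal K (degSet J (fun i => g.1 i 0) (fun i => g.1 i 1)) := by
  have hmem : ∀ f, f ∈ J.map (coordChange g) ↔ ∃ h ∈ J, coordChange g h = f := fun f =>
    Ideal.mem_map_iff_of_surjective (coordChange g) (coordChange_surjective g)
  have hz' : ∀ k f, coordChange g⁻¹ (X 2) ^ k * f ∈ J → f ∈ J := by
    intro k
    induction k with
    | zero => intro f hf; simpa using hf
    | succ k ih =>
      intro f hf
      rw [pow_succ, mul_assoc] at hf
      exact hz _ (ih _ hf)
  refine le_antisymm (Ideal.span_le.2 ?_) (Ideal.span_le.2 ?_)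
  · rintro _ ⟨f, hf, e, he, rfl⟩
    obtain ⟨h, hh, rfl⟩ := (hmem f).1 hf
    replace he := isInitialExponent_homogeneousComponent he
    rw [homogeneousComponent_coordChange] at he
    replace hh := hJ h hh e.degree
    have hhom := homogeneousComponent_isHomogeneous e.degree h
    set h' := homogeneousComponent e.degree h
    have hhom' := isHomogeneous_coordChange g hhom
    obtain ⟨q, hq, hqe⟩ := exists_eq_X_pow_mul hhom' he
    obtain ⟨f, rfl⟩ := coordChange_surjective g q
    have h1 : h' = coordChange g⁻¹ (X 2) ^ e 2 * f := by
      refine coordChange_injective g ?_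
      rw [hq, map_mul, map_pow, coordChange_coordChange_inv]
    -- The power of `z` in the initial monomial divides the whole form, and it can be cancelled
    -- because `z` is a nonzerodivisor modulo the transformed ideal.
    have hfJ : f ∈ J := hz' (e 2) f (h1 ▸ hh)
    have hne : coordChange g f ≠ 0 := by
      intro h0
      have := hqe.1
      rw [h0] at this
      simp at this
    rw [hq] at hhom'
    obtain ⟨N, -, hN⟩ := isHomogeneous_of_mul (isHomogeneous_X_pow 2 (e 2))
      (pow_ne_zero _ (X_ne_zero _)) hne hhom'
    obtain ⟨h2, h3, h4⟩ := evalLine_of_isInitialExponent hN hqe (by simp)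
    simp only [expXY_zero, expXY_one] at h3 h4
    have hfN : f.IsHomogeneous N := by
      have := isHomogeneous_coordChange g⁻¹ hN
      have h5 := coordChange_coordChange_inv g⁻¹ f
      rw [inv_inv] at h5
      rwa [h5] at this
    have h6 : (X 0 ^ e 0 * X 1 ^ e 1 : MvPolynomial (Fin 3) K) ∈
        degIdeal K (degSet J (fun i => g.1 i 0) (fun i => g.1 i 1)) := by
      refine Ideal.subset_span ⟨(e 0, e 1), ⟨f, hfJ, h4 ▸ hfN, ?_, ?_⟩, rfl⟩
      · rwa [← evalLine_coordChange]
      · rwa [← evalLine_coordChange]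
    have h7 : monomial e 1 = (X 2 ^ e 2 * (X 0 ^ e 0 * X 1 ^ e 1) : MvPolynomial (Fin 3) K) := by
      rw [← monomial_expXY, X_pow_eq_monomial, monomial_mul, one_mul, single_add_expXY]
    rw [h7]
    exact Ideal.mul_mem_left _ _ h6
  · rintro _ ⟨⟨i, j⟩, ⟨f, hf, hfN, h0, hi⟩, rfl⟩
    refine Ideal.subset_span ⟨coordChange g f, Ideal.mem_map_of_mem _ hf, expXY i j, ?_, ?_⟩
    · rw [← evalLine_coordChange] at h0 hi
      have := isInitialExponent_of_evalLine (isHomogeneous_coordChange g hfN) h0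
      simp only at hi
      rwa [hi, Nat.add_sub_cancel_left] at this
    · exact (monomial_expXY i j).symm

/-- The pulled-back form defines the line spanned by the first two columns of `g`. As it avoids the
points of the configuration, it is a nonzerodivisor modulo their symbolic powers. -/
theorem coordChange_inv_X_two_notMem_lineIdeal {g : GL (Fin 3) K} {x : Fin 3 → K}
    (hx : det3 (fun i => g.1 i 0) (fun i => g.1 i 1) x ≠ 0) :
    coordChange g⁻¹ (X 2) ∉ lineIdeal x := by
  intro h
  have h1 := eval_eq_zero_of_mem_lineIdeal h
  rw [eval_coordChange, eval_X] at h1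
  refine hx ?_
  set y := (g⁻¹ : GL (Fin 3) K).1.mulVec x
  have h2 : x = g.1.mulVec y := by
    rw [Matrix.mulVec_mulVec, ← Units.val_mul, mul_inv_cancel, Units.val_one, Matrix.one_mulVec]
  rw [h2]
  simp only [det3, Matrix.mulVec, dotProduct, Fin.sum_univ_three, h1]
  ring

theorem GeneralPosition.initialIdeal_eq [Infinite K] {r : ℕ} [NeZero r] {M : Fin 3 → Fin 3 → K}
    {v : Fin r → Fin 3 → K} (hC : ConicThrough M v) {g : GL (Fin 3) K}
    (h : GeneralPosition M v (fun i => g.1 i 0) (fun i => g.1 i 1)) (m : ℕ) :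
    initialIdeal ((symbolicPower (coneIdeal v) m).map (coordChange g)) =
      degIdeal K (degSet (symbolicPower (coneIdeal v) m) (fun i => g.1 i 0) (fun i => g.1 i 1)) :=
  initialIdeal_map_coordChange
    (fun _ hf k => homogeneousComponent_mem_symbolicPower hC.pairwiseIndep hf k) g
    fun _ hf => mem_symbolicPower_of_mul_mem hC.pairwiseIndep
      (fun i => coordChange_inv_X_two_notMem_lineIdeal (h.det_ne_zero i)) hf

/-! ### Generic behaviour of the restriction to a line -/

/-- The restriction of a polynomial to the line `t ↦ t • a + b` with generic `a` and `b`. -/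
noncomputable def genericRes :
    MvPolynomial (Fin 3) K →ₐ[K] Polynomial (MvPolynomial (Fin 3 × Fin 3) K) :=
  aeval fun i => Polynomial.C (X (i, 0)) * Polynomial.X + Polynomial.C (X (i, 1))

theorem map_genericRes (x : Fin 3 × Fin 3 → K) (f : MvPolynomial (Fin 3) K) :
    (genericRes f).map (eval x) = res (fun i => x (i, 0)) (fun i => x (i, 1)) f := by
  induction f using MvPolynomial.induction_on with
  | C a =>
    simp only [genericRes, res, algHom_C, Polynomial.algebraMap_apply]
    simp
  | add f h hf hh => rw [map_add, Polynomial.map_add, map_add, hf, hh]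
  | mul_X f i hf =>
    rw [map_mul, Polynomial.map_mul, map_mul, hf]
    simp [genericRes, res]

open Classical in
/-- The elements of `degSet` that are at least `μ`. -/
noncomputable def degFinset (J : Ideal (MvPolynomial (Fin 3) K)) (x : Fin 3 × Fin 3 → K)
    (N μ : ℕ) : Finset ℕ :=
  (Finset.range (N + 1)).filter fun n =>
    n ∈ degSet J (fun i => x (i, 0)) (fun i => x (i, 1)) N ∧ μ ≤ n

theorem mem_degFinset {J : Ideal (MvPolynomial (Fin 3) K)} {x : Fin 3 × Fin 3 → K} {N μ n : ℕ} :
    n ∈ degFinset J x N μ ↔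
      n ∈ degSet J (fun i => x (i, 0)) (fun i => x (i, 1)) N ∧ μ ≤ n := by
  classical
  rw [degFinset, Finset.mem_filter, Finset.mem_range, and_iff_right_iff_imp]
  exact fun h => Nat.lt_succ_of_le (FatPoints.le_of_mem_degSet h.1)

/-- The number of degrees that are at least `μ` is lower semicontinuous. -/
theorem exists_card_degFinset_le (J : Ideal (MvPolynomial (Fin 3) K)) (x₀ : Fin 3 × Fin 3 → K)
    (N μ : ℕ) : ∃ F : MvPolynomial (Fin 3 × Fin 3) K, eval x₀ F ≠ 0 ∧
      ∀ x, eval x F ≠ 0 → (degFinset J x₀ N μ).card ≤ (degFinset J x N μ).card := by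
  have hf : ∀ n : degFinset J x₀ N μ, ∃ f ∈ J, f.IsHomogeneous N ∧
      res (fun i => x₀ (i, 0)) (fun i => x₀ (i, 1)) f ≠ 0 ∧
      (res (fun i => x₀ (i, 0)) (fun i => x₀ (i, 1)) f).natDegree = n :=
    fun n => (mem_degFinset.1 n.2).1
  choose f hfJ hfN hf0 hfn using hf
  have heval : ∀ x, eval x (Matrix.of fun n n' : degFinset J x₀ N μ =>
      (genericRes (f n)).coeff n').det = (Matrix.of fun n n' : degFinset J x₀ N μ =>
        (res (fun i => x (i, 0)) (fun i => x (i, 1)) (f n)).coeff n').det := by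
    intro x
    rw [RingHom.map_det]
    congr 1
    ext n n'
    rw [RingHom.mapMatrix_apply, Matrix.map_apply, Matrix.of_apply, Matrix.of_apply,
      ← map_genericRes, Polynomial.coeff_map]
  refine ⟨(Matrix.of fun n n' : degFinset J x₀ N μ => (genericRes (f n)).coeff n').det, ?_,
    fun x hx => ?_⟩
  -- At `x₀` the form `f n` restricts to degree exactly `n`, so the coefficient matrix is triangular
  -- with nonzero leading coefficients on the diagonal.
  · rw [heval, Matrix.det_of_isLowerTriangular]
    · refine Finset.prod_ne_zero_iff.2 fun n _ => ?_
      rw [Matrix.of_apply]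
      nth_rewrite 1 [← hfn n]
      exact Polynomial.leadingCoeff_ne_zero.2 (hf0 n)
    · intro n n' hlt
      rw [Matrix.of_apply]
      refine Polynomial.coeff_eq_zero_of_natDegree_lt ?_
      rw [hfn n]
      exact hlt
  · rw [heval] at hx
    let L : (degFinset J x₀ N μ → K) →ₗ[K] Polynomial K := Fintype.linearCombination K
      fun n => res (fun i => x (i, 0)) (fun i => x (i, 1)) (f n)
    let Λ : (degFinset J x₀ N μ → K) →ₗ[K] (degFinset J x N μ → K) :=
      LinearMap.pi fun d => (Polynomial.lcoeff K d).comp L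
    -- Where the minor is nonzero, a nontrivial combination has a nonzero coefficient at some index
    -- at least `μ`. Its own degree then belongs to `degFinset J x N μ`, and the coefficient there
    -- does not vanish. So the dimension is at most the number of such degrees.
    have hΛ : Function.Injective Λ := by
      rw [← LinearMap.ker_eq_bot, LinearMap.ker_eq_bot']
      intro c hc
      by_contra hne
      have hcoeff : ∃ n' : degFinset J x₀ N μ, (L c).coeff n' ≠ 0 := by
        by_contra! h
        refine hne (Matrix.eq_zero_of_vecMul_eq_zero hx (funext fun n' => ?_))
        have := h n'
        simpa [L, Fintype.linearCombination_apply, Matrix.vecMul, dotProduct,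
          Polynomial.finsetSum_coeff] using this
      obtain ⟨n', hn'⟩ := hcoeff
      have hL0 : L c ≠ 0 := fun h => hn' (by rw [h, Polynomial.coeff_zero])
      have hLf : L c = res (fun i => x (i, 0)) (fun i => x (i, 1)) (∑ n, c n • f n) := by
        simp [L, Fintype.linearCombination_apply]
      have hmem : (L c).natDegree ∈ degFinset J x N μ := by
        refine mem_degFinset.2 ⟨⟨∑ n, c n • f n, ?_, ?_, hLf ▸ hL0, by rw [hLf]⟩,
          (mem_degFinset.1 n'.2).2.trans (Polynomial.le_natDegree_of_ne_zero hn')⟩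
        · exact J.sum_mem fun n _ => by
            rw [smul_eq_C_mul]; exact J.mul_mem_left _ (hfJ n)
        · exact IsHomogeneous.sum _ _ _ fun n _ => by
            rw [smul_eq_C_mul]; exact (hfN n).C_mul _
      have := congrFun hc ⟨_, hmem⟩
      exact hL0 (Polynomial.leadingCoeff_eq_zero.1 this)
    have := LinearMap.finrank_le_finrank_of_injective hΛ
    simpa using this

theorem exists_forall_card_degFinset_le (J : Ideal (MvPolynomial (Fin 3) K)) (N μ : ℕ) :
    ∃ F : MvPolynomial (Fin 3 × Fin 3) K, F ≠ 0 ∧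
      ∀ x, eval x F ≠ 0 → ∀ y, (degFinset J y N μ).card ≤ (degFinset J x N μ).card := by
  have hb : BddAbove (Set.range fun y => (degFinset J y N μ).card) := by
    refine ⟨N + 1, ?_⟩
    rintro _ ⟨y, rfl⟩
    classical exact (Finset.card_filter_le _ _).trans (Finset.card_range _).le
  obtain ⟨x₀, hx₀⟩ := Nat.sSup_mem (Set.range_nonempty _) hb
  obtain ⟨F, hF, hF'⟩ := exists_card_degFinset_le J x₀ N μ
  refine ⟨F, fun h => hF (by rw [h, map_zero]), fun x hx y => ?_⟩
  refine le_trans ?_ (hF' x hx)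
  rw [show (degFinset J x₀ N μ).card = _ from hx₀]
  exact le_csSup hb ⟨y, rfl⟩

/-- Consecutive counts differ by the indicator of membership, so the tail counts determine the set.
The value `μ = N + 1` serves as the empty end of the tails. -/
theorem degSet_eq_of_card_eq {J : Ideal (MvPolynomial (Fin 3) K)} {x y : Fin 3 × Fin 3 → K} {N : ℕ}
    (h : ∀ μ ≤ N + 1, (degFinset J x N μ).card = (degFinset J y N μ).card) :
    degSet J (fun i => x (i, 0)) (fun i => x (i, 1)) N =
      degSet J (fun i => y (i, 0)) (fun i => y (i, 1)) N := by
  classical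
  have key : ∀ (x : Fin 3 × Fin 3 → K) (n : ℕ), (degFinset J x N n).card =
      (degFinset J x N (n + 1)).card +
        if n ∈ degSet J (fun i => x (i, 0)) (fun i => x (i, 1)) N then 1 else 0 := by
    intro x n
    split_ifs with hn
    · rw [← Finset.card_insert_of_notMem (a := n) fun h => by
        have := (mem_degFinset.1 h).2; omega]
      congr 1
      ext k
      rw [Finset.mem_insert, mem_degFinset, mem_degFinset]
      constructor
      · rintro ⟨h1, h2⟩
        rcases h2.eq_or_lt with h3 | h3
        · exact Or.inl h3.symm
        · exact Or.inr ⟨h1, h3⟩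
      · rintro (rfl | ⟨h1, h2⟩)
        · exact ⟨hn, le_rfl⟩
        · exact ⟨h1, by omega⟩
    · rw [add_zero]
      congr 1
      ext k
      rw [mem_degFinset, mem_degFinset]
      refine and_congr_right fun hk => ⟨fun h2 => ?_, fun h2 => by omega⟩
      rcases h2.eq_or_lt with h3 | h3
      · exact absurd (h3 ▸ hk) hn
      · exact h3
  ext n
  by_cases hn : n ≤ N
  · have h1 := key x n
    have h2 := key y n
    rw [h n (by omega), h (n + 1) (by omega)] at h1
    rw [h1, add_right_inj] at h2
    by_cases hx : n ∈ degSet J (fun i => x (i, 0)) (fun i => x (i, 1)) N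
    · rw [if_pos hx] at h2
      exact ⟨fun _ => by_contra fun hy => one_ne_zero (h2.trans (if_neg hy)), fun _ => hx⟩
    · rw [if_neg hx] at h2
      exact ⟨fun h => absurd h hx, fun hy => absurd (h2.trans (if_pos hy)) zero_ne_one⟩
  · exact ⟨fun h => absurd (FatPoints.le_of_mem_degSet h) hn,
      fun h => absurd (FatPoints.le_of_mem_degSet h) hn⟩

theorem exists_degSet_eq (J : Ideal (MvPolynomial (Fin 3) K)) (B : ℕ) :
    ∃ F : MvPolynomial (Fin 3 × Fin 3) K, F ≠ 0 ∧
      ∀ x, eval x F ≠ 0 → ∀ y, eval y F ≠ 0 → ∀ N < B,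
        degSet J (fun i => x (i, 0)) (fun i => x (i, 1)) N =
          degSet J (fun i => y (i, 0)) (fun i => y (i, 1)) N := by
  choose F hF0 hF using exists_forall_card_degFinset_le J
  have hne : ∀ x, eval x (∏ N ∈ Finset.range B, ∏ μ ∈ Finset.range (N + 2), F N μ) ≠ 0 →
      ∀ N < B, ∀ μ ≤ N + 1, eval x (F N μ) ≠ 0 := by
    intro x hx N hN μ hμ
    rw [map_prod] at hx
    have := Finset.prod_ne_zero_iff.1 hx N (Finset.mem_range.2 hN)
    rw [map_prod] at this
    exact Finset.prod_ne_zero_iff.1 this μ (Finset.mem_range.2 (by omega))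
  refine ⟨∏ N ∈ Finset.range B, ∏ μ ∈ Finset.range (N + 2), F N μ,
    Finset.prod_ne_zero_iff.2 fun N _ => Finset.prod_ne_zero_iff.2 fun μ _ => hF0 N μ,
    fun x hx y hy N hN => degSet_eq_of_card_eq fun μ hμ => ?_⟩
  exact le_antisymm (hF N μ y (hne y hy N hN μ hμ) x) (hF N μ x (hne x hx N hN μ hμ) y)

theorem exists_GL_eval_ne_zero [Infinite K] {F : MvPolynomial (Fin 3 × Fin 3) K} (hF : F ≠ 0) :
    ∃ g : GL (Fin 3) K, eval (fun ij => g.1 ij.1 ij.2) F ≠ 0 := by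
  have h1 : F * (Matrix.mvPolynomialX (Fin 3) (Fin 3) K).det ≠ 0 :=
    mul_ne_zero hF (Matrix.det_mvPolynomialX_ne_zero _ _)
  obtain ⟨x, hx⟩ : ∃ x, eval x (F * (Matrix.mvPolynomialX (Fin 3) (Fin 3) K).det) ≠ 0 := by
    by_contra! h
    exact h1 (MvPolynomial.funext fun x => by rw [h x, map_zero])
  rw [map_mul] at hx
  have h2 := right_ne_zero_of_mul hx
  rw [RingHom.map_det] at h2
  have h3 : (eval x).mapMatrix (Matrix.mvPolynomialX (Fin 3) (Fin 3) K) =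
      Matrix.of fun i j => x (i, j) := by
    ext i j
    simp [Matrix.mvPolynomialX_apply]
  rw [h3] at h2
  exact ⟨Matrix.GeneralLinearGroup.mkOfDetNeZero _ h2, left_ne_zero_of_mul hx⟩

section

variable {r : ℕ} [NeZero r] {M : Fin 3 → Fin 3 → K} {v : Fin r → Fin 3 → K}

theorem exists_generalPosition_of_eval_ne_zero [Infinite K] (hC : ConicThrough M v) :
    ∃ F : MvPolynomial (Fin 3 × Fin 3) K, F ≠ 0 ∧ ∀ x, eval x F ≠ 0 →
      GeneralPosition M v (fun i => x (i, 0)) (fun i => x (i, 1)) := by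
  have hinj : Function.Injective fun i : Fin 3 => ((i, 0) : Fin 3 × Fin 3) := fun i j h => by
    simpa using h
  let D : Fin r → MvPolynomial (Fin 3 × Fin 3) K := fun i =>
    (X (1, 0) * X (2, 1) - X (2, 0) * X (1, 1)) * C (v i 0) +
      (X (2, 0) * X (0, 1) - X (0, 0) * X (2, 1)) * C (v i 1) +
      (X (0, 0) * X (1, 1) - X (1, 0) * X (0, 1)) * C (v i 2)
  have hD : ∀ i x, eval x (D i) = det3 (fun i => x (i, 0)) (fun i => x (i, 1)) (v i) := by
    intro i x
    simp [D, det3]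
  have hD0 : ∀ i, D i ≠ 0 := by
    intro i h0
    obtain ⟨w, hw⟩ := hC.pairwiseIndep i (i + 1) (fin_ne_add_one hC.one_lt i)
    have h1 := hD i fun jk => if jk.2 = 0 then v (i + 1) jk.1 else w jk.1
    rw [h0, map_zero] at h1
    refine zero_ne_one (h1.trans ?_)
    rw [← hw]
    simp [det3]
    ring
  refine ⟨rename (fun i => (i, 0)) (quadForm M * polygonForm v) * ∏ i, D i,
    mul_ne_zero ?_ (Finset.prod_ne_zero_iff.2 fun i _ => hD0 i), fun x hx => ?_⟩
  · rw [Ne, map_eq_zero_iff _ (rename_injective _ hinj), mul_eq_zero, not_or]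
    refine ⟨hC.irreducible.ne_zero, Finset.prod_ne_zero_iff.2 fun i _ => ?_⟩
    obtain ⟨w, hw⟩ := hC.pairwiseIndep i (i + 1) (fin_ne_add_one hC.one_lt i)
    exact lineForm_ne_zero hw
  · rw [map_mul, eval_rename, map_mul, polygonForm, map_prod, map_prod] at hx
    have h1 := left_ne_zero_of_mul hx
    have h2 := right_ne_zero_of_mul hx
    refine ⟨left_ne_zero_of_mul h1, fun i => ?_, fun i => ?_⟩
    · have := Finset.prod_ne_zero_iff.1 (right_ne_zero_of_mul h1) i (Finset.mem_univ i)
      rwa [eval_lineForm] at this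
    · have := Finset.prod_ne_zero_iff.1 h2 i (Finset.mem_univ i)
      rwa [hD] at this

/-- One nonzero polynomial must control all degrees at once. General position alone settles every
degree beyond the bound, so only finitely many semicontinuity conditions are multiplied together. -/
theorem exists_isGenericInitialIdeal [Infinite K] (hC : ConicThrough M v) (m : ℕ) :
    ∃ J, IsGenericInitialIdeal (symbolicPower (coneIdeal v) m) J := by
  obtain ⟨F₁, hF₁, h₁⟩ := exists_generalPosition_of_eval_ne_zero hC
  obtain ⟨F₂, hF₂, h₂⟩ := exists_degSet_eq (symbolicPower (coneIdeal v) m)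
    (max r 4 * ((m + 1) / 2) + min r 4)
  obtain ⟨g₀, hg₀⟩ := exists_GL_eval_ne_zero (mul_ne_zero hF₁ hF₂)
  refine ⟨initialIdeal ((symbolicPower (coneIdeal v) m).map (coordChange g₀)), F₁ * F₂,
    mul_ne_zero hF₁ hF₂, fun g hg => ?_⟩
  rw [map_mul] at hg hg₀
  have hp := h₁ _ (left_ne_zero_of_mul hg)
  have hp₀ := h₁ _ (left_ne_zero_of_mul hg₀)
  rw [hp.initialIdeal_eq hC, hp₀.initialIdeal_eq hC]
  congr 1
  funext N
  by_cases hN : N < max r 4 * ((m + 1) / 2) + min r 4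
  · exact h₂ _ (right_ne_zero_of_mul hg) _ (right_ne_zero_of_mul hg₀) N hN
  · ext n
    exact ⟨fun h => hp₀.mem_degSet hC (not_lt.1 hN) (FatPoints.le_of_mem_degSet h),
      fun h => hp.mem_degSet hC (not_lt.1 hN) (FatPoints.le_of_mem_degSet h)⟩

theorem isGenericInitialIdeal_gin {I : Ideal (MvPolynomial (Fin 3) K)}
    (h : ∃ J, IsGenericInitialIdeal I J) : IsGenericInitialIdeal I (gin I) := by
  rw [gin, dif_pos h]
  exact h.choose_spec

theorem exists_gin_eq_degIdeal [Infinite K] (hC : ConicThrough M v) (m : ℕ) :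
    ∃ a b, GeneralPosition M v a b ∧ gin (symbolicPower (coneIdeal v) m) =
      degIdeal K (degSet (symbolicPower (coneIdeal v) m) a b) := by
  obtain ⟨F₁, hF₁, h₁⟩ := exists_generalPosition_of_eval_ne_zero hC
  obtain ⟨F₂, hF₂, h₂⟩ := isGenericInitialIdeal_gin (exists_isGenericInitialIdeal hC m)
  obtain ⟨g, hg⟩ := exists_GL_eval_ne_zero (mul_ne_zero hF₁ hF₂)
  rw [map_mul] at hg
  have hp := h₁ _ (left_ne_zero_of_mul hg)
  exact ⟨_, _, hp, by rw [← h₂ g (right_ne_zero_of_mul hg), hp.initialIdeal_eq hC]⟩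

end

/-! ### Newton polytopes and limiting shapes -/

theorem isGeneratedInXY_degIdeal (S : ℕ → Set ℕ) : IsGeneratedInXY (degIdeal K S) :=
  ⟨_, rfl⟩

theorem mem_degIdeal_of_mem {S : ℕ → Set ℕ} {i j : ℕ} (h : i ∈ S (i + j)) :
    (X 0 ^ i * X 1 ^ j : MvPolynomial (Fin 3) K) ∈ degIdeal K S :=
  Ideal.subset_span ⟨(i, j), h, rfl⟩

theorem exists_le_of_mem_degIdeal {S : ℕ → Set ℕ} {i j : ℕ}
    (h : (X 0 ^ i * X 1 ^ j : MvPolynomial (Fin 3) K) ∈ degIdeal K S) :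
    ∃ i' j', i' ≤ i ∧ j' ≤ j ∧ i' ∈ S (i' + j') := by
  have h1 : degIdeal K S = Ideal.span ((fun e => monomial e (1 : K)) ''
      ((fun e : ℕ × ℕ => expXY e.1 e.2) '' {e | e.1 ∈ S (e.1 + e.2)})) := by
    rw [degIdeal, Set.image_image]
    simp only [monomial_expXY]
  rw [h1, ← monomial_expXY, mem_ideal_span_monomial_image] at h
  obtain ⟨_, ⟨⟨i', j'⟩, he, rfl⟩, hle⟩ := h (expXY i j) (by
    rw [mem_support_iff, coeff_monomial, if_pos rfl]; exact one_ne_zero)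
  exact ⟨i', j', by simpa using hle 0, by simpa using hle 1, he⟩

theorem Ici_subset_convexHull_range_natCast :
    Set.Ici (0 : ℝ) ⊆ convexHull ℝ (Set.range ((↑) : ℕ → ℝ)) := by
  intro x hx
  refine segment_subset_convexHull (𝕜 := ℝ) (Set.mem_range_self ⌊x⌋₊)
    (Set.mem_range_self (⌊x⌋₊ + 1)) ?_
  rw [segment_eq_Icc (by push_cast; linarith)]
  exact ⟨Nat.floor_le hx, by push_cast; exact (Nat.lt_floor_add_one x).le⟩

/-- An ideal absorbs multiplication by `x ^ k * y ^ l`, and the convex hull of the lattice points of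
the quadrant contains the whole quadrant. -/
theorem add_mem_newtonPolytope {J : Ideal (MvPolynomial (Fin 3) K)} {q : ℝ × ℝ}
    (hq : q ∈ newtonPolytope J) {x y : ℝ} (hx : 0 ≤ x) (hy : 0 ≤ y) :
    q + (x, y) ∈ newtonPolytope J := by
  have h1 : (x, y) ∈ convexHull ℝ (Set.range ((↑) : ℕ → ℝ) ×ˢ Set.range ((↑) : ℕ → ℝ)) := by
    rw [convexHull_prod]
    exact ⟨Ici_subset_convexHull_range_natCast hx, Ici_subset_convexHull_range_natCast hy⟩
  have h2 := Set.add_mem_add hq h1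
  rw [newtonPolytope, ← convexHull_add] at h2
  refine convexHull_mono ?_ h2
  rintro _ ⟨_, ⟨i, j, hij, rfl⟩, ⟨_, _⟩, ⟨⟨k, rfl⟩, ⟨l, rfl⟩⟩, rfl⟩
  refine ⟨i + k, j + l, ?_, by simp⟩
  rw [pow_add, pow_add, mul_mul_mul_comm]
  exact J.mul_mem_right _ hij

theorem mem_newtonPolytope_of_le {J : Ideal (MvPolynomial (Fin 3) K)} {α β : ℕ} (hα : 0 < α)
    (hβ : 0 < β) (hαJ : (X 0 ^ α * X 1 ^ 0 : MvPolynomial (Fin 3) K) ∈ J)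
    (hβJ : (X 0 ^ 0 * X 1 ^ β : MvPolynomial (Fin 3) K) ∈ J) {x y : ℝ} (hx : 0 ≤ x) (hy : 0 ≤ y)
    (hxy : 1 ≤ x / α + y / β) : (x, y) ∈ newtonPolytope J := by
  have hα' : (0 : ℝ) < α := by exact_mod_cast hα
  have hβ' : (0 : ℝ) < β := by exact_mod_cast hβ
  have h1 : ((α : ℝ), (0 : ℝ)) ∈ newtonPolytope J :=
    subset_convexHull ℝ _ ⟨α, 0, hαJ, by simp⟩
  have h2 : ((0 : ℝ), (β : ℝ)) ∈ newtonPolytope J :=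
    subset_convexHull ℝ _ ⟨0, β, hβJ, by simp⟩
  by_cases hxα : (α : ℝ) ≤ x
  · have := add_mem_newtonPolytope h1 (sub_nonneg.2 hxα) hy
    simpa using this
  · have hlt : x / α < 1 := (div_lt_one hα').2 (not_le.1 hxα)
    have h3 : (x / α) • ((α : ℝ), (0 : ℝ)) + (1 - x / α) • ((0 : ℝ), (β : ℝ)) ∈
        newtonPolytope J :=
      convex_convexHull ℝ _ h1 h2 (by positivity) (by linarith) (by ring)
    have h4 : (1 - x / α) * β ≤ y := by
      rw [← le_div_iff₀ hβ']; linarith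
    have := add_mem_newtonPolytope h3 (le_refl 0) (sub_nonneg.2 h4)
    convert this using 1
    ext
    · simp [hα'.ne']
    · simp

theorem isClosed_regionAboveLine (s t : ℝ) : IsClosed (regionAboveLine s t) := by
  have h : Continuous fun q : ℝ × ℝ => q.1 / s + q.2 / t := by fun_prop
  exact (isClosed_le continuous_const continuous_fst).inter
    ((isClosed_le continuous_const continuous_snd).inter (isClosed_le continuous_const h))

/-- A system of monomial ideals has limiting shape `regionAboveLine s t` if its monomials lie above
the `m`-th multiple of the line, and powers of `x` and of `y` close to this line occur. -/
theorem isLimitingShape_of_bounds {a : ℕ → Ideal (MvPolynomial (Fin 3) K)} {s t c : ℝ} (hs : 0 < s)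
    (ht : 0 < t) (hlow : ∀ m i j : ℕ, (X 0 ^ i * X 1 ^ j : MvPolynomial (Fin 3) K) ∈ a m →
      (m : ℝ) ≤ i / s + j / t)
    (hx : ∀ m : ℕ, ∃ α : ℕ, (X 0 ^ α * X 1 ^ 0 : MvPolynomial (Fin 3) K) ∈ a m ∧
      (α : ℝ) ≤ s * m + c)
    (hy : ∀ m : ℕ, ∃ β : ℕ, (X 0 ^ 0 * X 1 ^ β : MvPolynomial (Fin 3) K) ∈ a m ∧
      (β : ℝ) ≤ t * m + c) :
    IsLimitingShape a (regionAboveLine s t) := by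
  refine ⟨isClosed_regionAboveLine s t, ?_⟩
  have hlim : Filter.Tendsto (fun m : ℕ => ENNReal.ofReal (c / m)) Filter.atTop (nhds 0) := by
    have := ENNReal.tendsto_ofReal (tendsto_const_div_atTop_nhds_zero_nat c)
    rwa [ENNReal.ofReal_zero] at this
  refine tendsto_of_tendsto_of_tendsto_of_le_of_le' tendsto_const_nhds hlim
    (Filter.Eventually.of_forall fun _ => zero_le) ?_
  filter_upwards [Filter.eventually_ge_atTop 1] with m hm
  have hm' : (0 : ℝ) < m := by exact_mod_cast hm
  obtain ⟨α, hα, hαc⟩ := hx m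
  obtain ⟨β, hβ, hβc⟩ := hy m
  have hα1 : s * m ≤ α := by
    have := hlow m α 0 hα
    rw [Nat.cast_zero, zero_div, add_zero, le_div_iff₀ hs] at this
    linarith
  have hβ1 : t * m ≤ β := by
    have := hlow m 0 β hβ
    rw [Nat.cast_zero, zero_div, zero_add, le_div_iff₀ ht] at this
    linarith
  have hα0 : (0 : ℝ) < α := (mul_pos hs hm').trans_le hα1
  have hβ0 : (0 : ℝ) < β := (mul_pos ht hm').trans_le hβ1
  have hc : 0 ≤ c := by linarith
  refine Metric.hausdorffEDist_le_of_mem_edist ?_ ?_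
  · rintro _ ⟨q, hq, rfl⟩
    refine ⟨_, ?_, (edist_self _).trans_le zero_le⟩
    have hsub : newtonPolytope (a m) ⊆
        {q : ℝ × ℝ | 0 ≤ q.1 ∧ 0 ≤ q.2 ∧ (m : ℝ) ≤ q.1 / s + q.2 / t} := by
      refine convexHull_min ?_ ?_
      · rintro _ ⟨i, j, hij, rfl⟩
        exact ⟨Nat.cast_nonneg _, Nat.cast_nonneg _, hlow m i j hij⟩
      · rintro ⟨x, y⟩ ⟨h1, h2, h3⟩ ⟨x', y'⟩ ⟨h1', h2', h3'⟩ u w hu hw huw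
        simp only at h1 h2 h3 h1' h2' h3'
        simp only [Prod.smul_mk, Prod.mk_add_mk, smul_eq_mul, Set.mem_ofPred_eq]
        refine ⟨by positivity, by positivity, ?_⟩
        have e : (u * x + w * x') / s + (u * y + w * y') / t =
            u * (x / s + y / t) + w * (x' / s + y' / t) := by ring
        rw [e]
        calc (m : ℝ) = u * m + w * m := by rw [← add_mul, huw, one_mul]
          _ ≤ _ := by gcongr
    obtain ⟨h1, h2, h3⟩ := hsub hq
    refine ⟨?_, ?_, ?_⟩
    · simp only [Prod.smul_fst, smul_eq_mul]; positivity
    · simp only [Prod.smul_snd, smul_eq_mul]; positivity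
    · simp only [Prod.smul_fst, Prod.smul_snd, smul_eq_mul]
      have e : 1 / (m : ℝ) * q.1 / s + 1 / (m : ℝ) * q.2 / t = (q.1 / s + q.2 / t) / m := by ring
      rw [e, le_div_iff₀ hm', one_mul]
      exact h3
  · rintro ⟨x, y⟩ ⟨hx0, hy0, hxy⟩
    simp only at hx0 hy0 hxy
    -- Translation by the difference of the intercepts moves the region into the scaled polytope,
    -- over a distance of at most `c / m`.
    refine ⟨(x + (α / m - s), y + (β / m - t)), ?_, ?_⟩
    · refine ⟨(m * x + (α - s * m), m * y + (β - t * m)), ?_, ?_⟩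
      · refine mem_newtonPolytope_of_le (by exact_mod_cast hα0) (by exact_mod_cast hβ0) hα hβ
          (add_nonneg (by positivity) (by linarith)) (add_nonneg (by positivity) (by linarith)) ?_
        -- Moving the point and the intercept by the same amount brings the ratio `x / s` closer to
        -- `1`: it cannot fall below `min 1 (x / s)`.
        have key : ∀ {x s α : ℝ}, 0 ≤ x → 0 < s → 0 < α → s * m ≤ α →
            0 ≤ (m * x + (α - s * m)) / α ∧
              min 1 (x / s) ≤ (m * x + (α - s * m)) / α := by
          intro x s α hx hs hα h
          refine ⟨div_nonneg (add_nonneg (by positivity) (by linarith)) hα.le, ?_⟩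
          rw [le_div_iff₀ hα]
          rcases le_total x s with h' | h'
          · have h1 : x / s ≤ 1 := (div_le_one hs).2 h'
            rw [min_eq_right h1]
            have h2 : x / s * s = x := div_mul_cancel₀ x hs.ne'
            nlinarith [mul_nonneg (sub_nonneg.2 h1) (sub_nonneg.2 h)]
          · rw [min_eq_left ((one_le_div hs).2 h')]
            nlinarith
        obtain ⟨k1, k2⟩ := key hx0 hs hα0 hα1
        obtain ⟨k3, k4⟩ := key hy0 ht hβ0 hβ1
        rcases le_total 1 (x / s) with h1 | h1
        · rw [min_eq_left h1] at k2; linarith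
        rcases le_total 1 (y / t) with h2 | h2
        · rw [min_eq_left h2] at k4; linarith
        rw [min_eq_right h1] at k2
        rw [min_eq_right h2] at k4
        linarith
      · ext
        · simp only [Prod.smul_mk, smul_eq_mul]; field_simp
        · simp only [Prod.smul_mk, smul_eq_mul]; field_simp
    · rw [edist_dist]
      refine ENNReal.ofReal_le_ofReal ?_
      have key : ∀ {s α : ℝ}, s * m ≤ α → α ≤ s * m + c → |α / m - s| ≤ c / m := by
        intro s α h1 h2
        have e : α / m - s = (α - s * m) / m := by field_simp
        rw [e, abs_of_nonneg (div_nonneg (by linarith) hm'.le)]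
        gcongr
        linarith
      rw [Prod.dist_eq, Real.dist_eq, Real.dist_eq]
      refine max_le ?_ ?_
      · simpa [abs_sub_comm] using key hα1 hαc
      · simpa [abs_sub_comm] using key hβ1 hβc

theorem isLimitingShape_gin [Infinite K] {r : ℕ} [NeZero r] {M : Fin 3 → Fin 3 → K}
    {v : Fin r → Fin 3 → K} (hC : ConicThrough M v) :
    IsLimitingShape (fun m => gin (symbolicPower (coneIdeal v) m))
      (regionAboveLine ((min r 4 : ℕ) / 2) ((max r 4 : ℕ) / 2)) := by
  have hr := hC.one_lt
  have hmin : (0 : ℝ) < (min r 4 : ℕ) := by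
    have : 0 < min r 4 := by rw [lt_min_iff]; omega
    exact_mod_cast this
  have hmax : (0 : ℝ) < (max r 4 : ℕ) := by
    have : 0 < max r 4 := by rw [lt_max_iff]; omega
    exact_mod_cast this
  have hhalf : ∀ m : ℕ, (((m + 1) / 2 : ℕ) : ℝ) ≤ (m + 1) / 2 := fun m => by
    have := @Nat.cast_div_le ℝ _ _ _ (m + 1) 2
    push_cast at this
    exact this
  -- This constant absorbs both the rounding in `(m + 1) / 2` and the summand `min r 4` in the bound
  -- for surjectivity.
  refine isLimitingShape_of_bounds (c := (max r 4 : ℕ) / 2 + 2 * (min r 4 : ℕ)) (by positivity)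
    (by positivity) (fun m i j hij => ?_) (fun m => ?_) fun m => ?_
  all_goals obtain ⟨a, b, hab, hgin⟩ := exists_gin_eq_degIdeal hC m
  · simp only [hgin] at hij
    obtain ⟨i', j', hi, hj, hmem⟩ := exists_le_of_mem_degIdeal hij
    have h1 := hab.le_of_mem_degSet hC hmem
    rw [Nat.add_sub_cancel_left] at h1
    have h2 : ((min r 4 : ℕ) : ℝ) * (max r 4 : ℕ) * m ≤
        2 * (max r 4 : ℕ) * i' + 2 * (min r 4 : ℕ) * j' := by exact_mod_cast h1
    have h3 : (i' : ℝ) ≤ i := by exact_mod_cast hi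
    have h4 : (j' : ℝ) ≤ j := by exact_mod_cast hj
    have h5 : (m : ℝ) ≤ i' / ((min r 4 : ℕ) / 2) + j' / ((max r 4 : ℕ) / 2) := by
      rw [div_add_div _ _ (by positivity) (by positivity), le_div_iff₀ (by positivity)]
      linarith
    refine h5.trans ?_
    gcongr
  · refine ⟨min r 4 * ((m + 1) / 2), ?_, ?_⟩
    · rw [hgin]
      exact mem_degIdeal_of_mem (by simpa using hab.mul_mem_degSet hC m)
    · rw [Nat.cast_mul]
      have := mul_le_mul_of_nonneg_left (hhalf m) hmin.le
      linarith
  · refine ⟨max r 4 * ((m + 1) / 2) + min r 4, ?_, ?_⟩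
    · rw [hgin]
      exact mem_degIdeal_of_mem (hab.mem_degSet hC (by simp) (by simp))
    · rw [Nat.cast_add, Nat.cast_mul]
      have := mul_le_mul_of_nonneg_left (hhalf m) hmax.le
      linarith

end FatPoints

theorem theorem1 {K : Type*} [Field K] [Infinite K] (r : ℕ) (hr : 1 < r)
    (p : Fin r → ℙ K (Fin 3 → K)) (hp : Function.Injective p)
    (hconic : LieOnIrreducibleConic (Set.range p))
    (I : Ideal (MvPolynomial (Fin 3) K)) (hI : I = pointsIdeal (Set.range p)) :
    (∀ m : ℕ, IsGenericInitialIdeal (symbolicPower I m) (gin (symbolicPower I m)) ∧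
      IsGeneratedInXY (gin (symbolicPower I m))) ∧
    (4 ≤ r → IsLimitingShape (fun m => gin (symbolicPower I m))
      (regionAboveLine 2 ((r : ℝ) / 2))) ∧
    (r = 2 ∨ r = 3 → IsLimitingShape (fun m => gin (symbolicPower I m))
      (regionAboveLine ((r : ℝ) / 2) 2)) := by
  have : NeZero r := ⟨by omega⟩
  obtain ⟨C, hC2, hCirr, hC0⟩ := hconic
  obtain ⟨M, rfl⟩ := FatPoints.exists_eq_quadForm hC2
  have hC : FatPoints.ConicThrough M fun i => (p i).rep :=
    ⟨hr, hCirr, hC2, FatPoints.pairwiseIndep_rep hp, fun i => hC0 _ ⟨i, rfl⟩⟩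
  rw [FatPoints.pointsIdeal_range_eq] at hI
  subst hI
  have hlim := FatPoints.isLimitingShape_gin hC
  refine ⟨fun m => ⟨FatPoints.isGenericInitialIdeal_gin
    (FatPoints.exists_isGenericInitialIdeal hC m), ?_⟩, fun h4 => ?_, fun h23 => ?_⟩
  · obtain ⟨a, b, -, hgin⟩ := FatPoints.exists_gin_eq_degIdeal hC m
    rw [hgin]
    exact FatPoints.isGeneratedInXY_degIdeal _
  · rw [min_eq_right h4, max_eq_left h4] at hlim
    norm_num at hlim
    exact hlim
  · have h4 : r ≤ 4 := by omega
    rw [min_eq_left h4, max_eq_right h4] at hlim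
    norm_num at hlim
    exact hlim
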